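/- Let $n\ge 0$, $M\ge 2$ and $R\ge 0$ be integers with $R\le \tfrac12\sqrt{M-1}$, and let $\rho>1$. Let $E_\rho\subset\mathbb C$ be the open Bernstein ellipse, that is, the open ellipse with foci $\pm1$ whose semi-axes sum up to $\rho$, and let $\overline{E_\rho}$ be its closure and $\partial E_\rho$ its boundary. Let $A:\overline{E_\rho}\to\mathbb C^{n\times n}$ and $\boldsymbol b:\overline{E_\rho}\to\mathbb C^{n}$ be analytic on $E_\rho$ and continuous on $\overline{E_\rho}$, with $A(z)$ invertible for every $z\in\overline{E_\rho}$. Put $\boldsymbol x(z)=A(z)^{-1}\boldsymbol b(z)$ and $\kappa_\rho=\max_{z\in\partial E_\rho}\|\boldsymbol x(z)\|_2$. Let $t_k=-1+\tfrac{2k}{M-1}$ for $k=0,\dots,M-1$ be $M$ equispaced points in $[-1,1]$, let $X=[\boldsymbol x(t_0)|\cdots|\boldsymbol x(t_{M-1})]\in\mathbb C^{n\times M}$, let $q_j$ be the Chebyshev polynomial (of the first kind) of degree $j$, let $\boldsymbol q_R(t)=[q_0(t),\dots,q_R(t)]^T$ and $Q=[\boldsymbol q_R(t_0)|\cdots|\boldsymbol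 q_R(t_{M-1})]\in\mathbb R^{(R+1)\times M}$, and define the vector-valued polynomial $$\boldsymbol p_R(t)=X\,Q^{T}(QQ^{T})^{-1}\,\boldsymbol q_R(t).$$ Then $\boldsymbol p_R$ is the least-squares fit of degree $R$ to the samples: it is the unique minimizer of $\sum_{k=0}^{M-1}\|\boldsymbol x(t_k)-\boldsymbol p(t_k)\|_2^2$ among all vector-valued polynomials $\boldsymbol p$ with coefficients in $\mathbb C^n$ and of degree at most $R$. Moreover, for every real $t\in\bigl(1,\tfrac{\rho+\rho^{-1}}2\bigr)$, the number $r=(t+\sqrt{t^2-1})/\rho$ satisfies $r<1$, and $$\|\boldsymbol x(t)-\boldsymbol p_R(t)\|_2\le 2\kappa_\rho\left[\frac1{1-r}+\frac{C(M,R)\,\rho}{(\rho-1)\sqrt{\rho^2r^2-1}}\right]r^{R+1},\qquad C(M,R)=\frac{5\sqrt5\,\sqrt{2R+1}\,\sqrt M}{\sqrt{2(M-1)}}.$$ -/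

import Mathlib

noncomputable section

namespace ChebExtrapolation

/-- The open Bernstein ellipse: the open ellipse with foci `1` and `-1` whose semi-axes
`(ρ + ρ⁻¹) / 2` and `(ρ - ρ⁻¹) / 2` sum up to `ρ`, that is, the set of the points whose distances
to the foci add up to less than `ρ + ρ⁻¹`, twice the major semi-axis. -/
def bernsteinEllipse (ρ : ℝ) : Set ℂ := {z | ‖z - 1‖ + ‖z + 1‖ < ρ + ρ⁻¹}

/-- The closed Bernstein ellipse. -/
def closedBernsteinEllipse (ρ : ℝ) : Set ℂ := {z | ‖z - 1‖ + ‖z + 1‖ ≤ ρ + ρ⁻¹}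

/-- The boundary curve of the Bernstein ellipse. -/
def bernsteinBoundary (ρ : ℝ) : Set ℂ := {z | ‖z - 1‖ + ‖z + 1‖ = ρ + ρ⁻¹}

/-- `f` is analytic on the open Bernstein ellipse and continuous on the closed one. -/
def AnalyticOnEllipse (ρ : ℝ) (f : ℂ → ℂ) : Prop :=
  AnalyticOnNhd ℂ f (bernsteinEllipse ρ) ∧ ContinuousOn f (closedBernsteinEllipse ρ)

/-- The solution `x(z) = A(z)⁻¹ b(z)` of the parametrized linear system, with the Euclidean norm. -/
def solution {n : ℕ} (A : ℂ → Matrix (Fin n) (Fin n) ℂ) (b : ℂ → Fin n → ℂ) (z : ℂ) :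
    EuclideanSpace ℂ (Fin n) :=
  WithLp.toLp 2 ((A z)⁻¹.mulVec (b z))

/-- The maximum of `‖x(z)‖₂` over the boundary of the Bernstein ellipse (a compact nonempty set, on
which the functions `x` considered below are continuous). -/
def kappa {n : ℕ} (ρ : ℝ) (x : ℂ → EuclideanSpace ℂ (Fin n)) : ℝ :=
  sSup ((fun z => ‖x z‖) '' bernsteinBoundary ρ)

/-- The `M` equispaced points `-1, -1 + Δt, …, 1` with `Δt = 2 / (M - 1)`. -/
def equiPoint (M : ℕ) (k : Fin M) : ℝ := -1 + (k : ℝ) * (2 / ((M : ℝ) - 1))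

/-- The history matrix, with the samples `x(t_k)` as columns. -/
def historyMatrix {n : ℕ} (M : ℕ) (x : ℂ → EuclideanSpace ℂ (Fin n)) :
    Matrix (Fin n) (Fin M) ℂ :=
  Matrix.of fun i k => x (equiPoint M k : ℂ) i

/-- The matrix whose `k`-th column contains the values at the `k`-th equispaced point of the
Chebyshev polynomials of degrees `0, …, R`. -/
def chebMatrix (M R : ℕ) : Matrix (Fin (R + 1)) (Fin M) ℝ :=
  Matrix.of fun j k => (Polynomial.Chebyshev.T ℝ ((j : ℕ) : ℤ)).eval (equiPoint M k)

/-- `Q† = Qᵀ (Q Qᵀ)⁻¹`, the pseudoinverse of a real matrix `Q` of full row rank. -/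
def rowPinv {m M : ℕ} (Q : Matrix (Fin m) (Fin M) ℝ) : Matrix (Fin M) (Fin m) ℝ :=
  Q.transpose * (Q * Q.transpose)⁻¹

/-- The coefficient matrix `C_p = X Q†` of the fit in the Chebyshev basis. -/
def fitCoeff {n : ℕ} (M R : ℕ) (x : ℂ → EuclideanSpace ℂ (Fin n)) :
    Matrix (Fin n) (Fin (R + 1)) ℂ :=
  historyMatrix M x * (rowPinv (chebMatrix M R)).map (fun a : ℝ => (a : ℂ))

/-- The vector-valued polynomial `p_R(t) = C_p (q_0(t), …, q_R(t))ᵀ`, where `q_k` is the Chebyshev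
polynomial of degree `k`, given as the vector of its polynomial entries. -/
def chebFit {n : ℕ} (M R : ℕ) (x : ℂ → EuclideanSpace ℂ (Fin n)) : Fin n → Polynomial ℂ :=
  fun i => ∑ j : Fin (R + 1),
    Polynomial.C (fitCoeff M R x i j) * Polynomial.Chebyshev.T ℂ ((j : ℕ) : ℤ)

/-- The value of a vector-valued polynomial. -/
def evalVec {n : ℕ} (p : Fin n → Polynomial ℂ) (z : ℂ) : EuclideanSpace ℂ (Fin n) :=
  WithLp.toLp 2 fun i => (p i).eval z

/-- `p` is a least-squares approximation of the `M` equispaced samples of `x` among the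
vector-valued polynomials of degree at most `R`: it minimizes the square of the Frobenius norm of
the matrix with the columns `x(t_k) - p(t_k)`. -/
def IsLeastSquaresFit {n : ℕ} (M R : ℕ) (x : ℂ → EuclideanSpace ℂ (Fin n))
    (p : Fin n → Polynomial ℂ) : Prop :=
  (∀ i, (p i).natDegree ≤ R) ∧
    ∀ v : Fin n → Polynomial ℂ, (∀ i, (v i).natDegree ≤ R) →
      ∑ k : Fin M, ‖x (equiPoint M k : ℂ) - evalVec p (equiPoint M k : ℂ)‖ ^ 2 ≤
        ∑ k : Fin M, ‖x (equiPoint M k : ℂ) - evalVec v (equiPoint M k : ℂ)‖ ^ 2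

/-- The constant `C(M, R) = 5 √5 √(2R + 1) √M / √(2 (M - 1))`. -/
def extrapConst (M R : ℕ) : ℝ :=
  5 * √5 * √(2 * (R : ℝ) + 1) * √(M : ℝ) / √(2 * ((M : ℝ) - 1))

/-- The rate `r = (t + √(t² - 1)) / ρ`. -/
def rate (ρ t : ℝ) : ℝ := (t + √(t ^ 2 - 1)) / ρ

end ChebExtrapolation

end

/-!
Let `J(w) = (w + w⁻¹) / 2` be the Joukowski map, so that `T_j(J(w)) = (w^j + w^(-j)) / 2`. Taking the
inner product with a fixed vector reduces the error bound to a scalar function `f`, analytic on the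
Bernstein ellipse and bounded by `K` on its boundary.

*Expansion.* The function `f ∘ J` is analytic in an annulus and invariant under `w ↦ w⁻¹`; its
Laurent series gives `f = ∑ a_j T_j` with `|a_j| ≤ 2 K ρ^(-j)` (`exists_hasSum_chebyshev`). At
`t = J(w)`, where `w = t + √(t² - 1) = ρ r`, the tail beyond degree `R` is at most
`2 K r^(R+1) / (1 - r)`, and on `[-1, 1]` it is at most `G = 2 K ρ^(-R) / (ρ - 1)`
(`norm_sub_eval_chebSum_le`).

*Stability.* The fit of degree `R` is the orthogonal projection of the samples onto the polynomials
of degree at most `R` (`sum_norm_sub_evalVec_sq`), which also makes it the unique minimizer. Hence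
the difference of the fit and the truncated series is the projection of the samples of the tail,
and the sum of its squares over the nodes is at most `M G²`. Its Chebyshev coefficients `c_j` satisfy
`2 (M - 1) / (125 (2 R + 1)) ∑ |c_j|² ≤ M G²`, by the singular value bound below, and the
Cauchy-Schwarz inequality with `|T_j(t)| ≤ w^j` gives the second term of the estimate
(`norm_eval_scalarFit_sub_le`).

*The singular value bound* (`sum_sq_le_sum_eval_sq`). Let `p = ∑ c_j T_j` have degree at most `R`,
with real coefficients. The substitution `x = cos θ` and the bound `p² ≤ (R + 1) ∑ c_j²` near the end
points give `∫ p² ≥ π / (16 (R + 1)) ∑ c_j²` over `[-1, 1]` (`sum_sq_le_polyInner_chebSum`). The error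
of the trapezoidal rule for `∫ p²` is at most `1 / (M - 1) * ∫ |2 p p'|`, which Markov's inequality
`∫ p'² ≤ R (R + 1)² (R + 2) / 4 * ∫ p²` (`polyInner_derivative_le`) bounds by a fixed multiple, less
than one, of `∫ p²`, because `4 R² ≤ M - 1` (`polyInner_self_le_sum_sq`). Markov's inequality is
proved by adding one Legendre polynomial at a time: their differential equation gives their values
and derivatives at the end points, and thus the norms of their derivatives.
-/

noncomputable section
namespace ChebExtrapolation

open Polynomial intervalIntegral

/-! ### Markov's inequality in the mean square on `[-1, 1]` -/

/-- The inner product `∫_{-1}^1 p q` of two real polynomials, as a bilinear form. -/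
def polyInner : LinearMap.BilinForm ℝ ℝ[X] :=
  LinearMap.mk₂ ℝ (fun p q => ∫ x in (-1 : ℝ)..1, p.eval x * q.eval x)
    (fun p₁ p₂ q => by
      simp only [eval_add, add_mul]
      exact integral_add (Continuous.intervalIntegrable (by fun_prop) _ _)
        (Continuous.intervalIntegrable (by fun_prop) _ _))
    (fun c p q => by simp [mul_assoc])
    (fun p q₁ q₂ => by
      simp only [eval_add, mul_add]
      exact integral_add (Continuous.intervalIntegrable (by fun_prop) _ _)
        (Continuous.intervalIntegrable (by fun_prop) _ _))
    (fun c p q => by simp [mul_left_comm])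

lemma polyInner_apply (p q : ℝ[X]) :
    polyInner p q = ∫ x in (-1 : ℝ)..1, p.eval x * q.eval x := rfl

lemma polyInner_comm (p q : ℝ[X]) : polyInner p q = polyInner q p := by
  simp [polyInner_apply, mul_comm]

lemma polyInner_mul_left (r p q : ℝ[X]) : polyInner (r * p) q = polyInner p (r * q) := by
  simp only [polyInner_apply, eval_mul]
  exact integral_congr fun x _ => by ring

lemma polyInner_self_nonneg (p : ℝ[X]) : 0 ≤ polyInner p p :=
  integral_nonneg (by norm_num) fun x _ => mul_self_nonneg _

lemma polyInner_sq_le (p q : ℝ[X]) :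
    polyInner p q ^ 2 ≤ polyInner p p * polyInner q q :=
  LinearMap.BilinForm.apply_sq_le_of_symm polyInner polyInner_self_nonneg
    ⟨fun p q => polyInner_comm p q⟩ p q

lemma eq_zero_of_polyInner_self {p : ℝ[X]} (h : polyInner p p = 0) : p = 0 := by
  by_contra hp
  refine h.not_gt ?_
  obtain ⟨c, hc, hc'⟩ : ∃ c ∈ Set.Icc (-1 : ℝ) 1, p.eval c ≠ 0 := by
    by_contra! hz
    exact hp (p.eq_zero_of_infinite_isRoot
      ((Set.Icc_infinite (by norm_num : (-1 : ℝ) < 1)).mono fun x hx => hz x hx))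
  exact integral_pos (by norm_num) (by fun_prop) (fun x _ => mul_self_nonneg _)
    ⟨c, hc, mul_self_pos.2 hc'⟩

lemma polyInner_derivative_left (p q : ℝ[X]) :
    polyInner (derivative p) q =
      p.eval 1 * q.eval 1 - p.eval (-1) * q.eval (-1) - polyInner p (derivative q) := by
  simp only [polyInner_apply]
  have := integral_mul_deriv_eq_deriv_mul (a := -1) (b := 1)
    (fun x _ => q.hasDerivAt x) (fun x _ => p.hasDerivAt x)
    (Continuous.intervalIntegrable (by fun_prop) _ _)
    (Continuous.intervalIntegrable (by fun_prop) _ _)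
  simp only [mul_comm (eval _ (derivative p)), mul_comm (eval _ p)]
  exact this

/-- A monic polynomial of degree `N` orthogonal to all polynomials of smaller degree (a multiple of
the Legendre polynomial) exists. -/
lemma exists_monic_orthogonal (N : ℕ) :
    ∃ L : ℝ[X], L.natDegree ≤ N ∧ L.coeff N = 1 ∧ ∀ q : ℝ[X], q.degree < N → polyInner L q = 0 := by
  have : FiniteDimensional ℝ (degreeLT ℝ N) := (degreeLTEquiv ℝ N).symm.finiteDimensional
  let Φ : degreeLT ℝ N →ₗ[ℝ] Module.Dual ℝ (degreeLT ℝ N) :=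
    polyInner.domRestrict₁₂ (degreeLT ℝ N) (degreeLT ℝ N)
  have hinj : Function.Injective Φ := by
    rw [← LinearMap.ker_eq_bot, LinearMap.ker_eq_bot']
    intro p hp
    exact Subtype.ext (eq_zero_of_polyInner_self (LinearMap.congr_fun hp p))
  obtain ⟨s, hs⟩ := (LinearMap.injective_iff_surjective_of_finrank_eq_finrank
    Subspace.dual_finrank_eq.symm).1 hinj ((polyInner (X ^ N)).domRestrict (degreeLT ℝ N))
  have hsd : (s : ℝ[X]).degree < N := mem_degreeLT.1 s.2
  refine ⟨X ^ N - (s : ℝ[X]), ?_, ?_, fun q hq => ?_⟩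
  · exact natDegree_le_of_degree_le ((degree_sub_le _ _).trans
      (max_le (degree_X_pow_le N) hsd.le))
  · simp [coeff_eq_zero_of_degree_lt hsd]
  · have := LinearMap.congr_fun hs ⟨q, mem_degreeLT.2 hq⟩
    rw [map_sub, LinearMap.sub_apply, sub_eq_zero]
    exact this.symm

/-- `x L' - N L` has degree less than `N`, whence `∫ x L' L = N ∫ L²`; integrate `x (L²)'` by
parts. -/
lemma eval_sq_add_eval_sq_of_orthogonal {N : ℕ} {L : ℝ[X]} (hdeg : L.natDegree ≤ N)
    (horth : ∀ q : ℝ[X], q.degree < N → polyInner L q = 0) :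
    L.eval 1 ^ 2 + L.eval (-1) ^ 2 = (2 * N + 1) * polyInner L L := by
  have hlow : (X * derivative L - (N : ℝ) • L).degree < (N : WithBot ℕ) := by
    rw [degree_lt_iff_coeff_zero]
    intro m hm
    rcases m with _ | m
    · obtain rfl : N = 0 := by omega
      simp
    · rw [coeff_sub, coeff_X_mul, coeff_derivative, coeff_smul, smul_eq_mul]
      rcases hm.eq_or_lt with h | h
      · rw [h]; push_cast; ring
      · rw [coeff_eq_zero_of_natDegree_lt (hdeg.trans_lt h)]; ring
  have h1 := horth _ hlow
  have h2 := polyInner_derivative_left (X * L) L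
  rw [derivative_mul, derivative_X, one_mul, map_add, LinearMap.add_apply,
    polyInner_mul_left X L, polyInner_comm (X * derivative L)] at h2
  rw [map_sub, map_smul, smul_eq_mul] at h1
  simp only [eval_mul, eval_X] at h2
  linear_combination -h2 + 2 * h1

/-- The Legendre differential equation `((x² - 1) L')' = N (N + 1) L`: the difference `q` of both
sides has degree less than `N`, and it is orthogonal to all polynomials of degree less than `N`
since the operator on the left is symmetric and does not raise degrees. -/
lemma legendre_ode_of_orthogonal {N : ℕ} {L : ℝ[X]} (hdeg : L.natDegree ≤ N)
    (horth : ∀ q : ℝ[X], q.degree < N → polyInner L q = 0) :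
    derivative ((X ^ 2 - 1) * derivative L) = ((N : ℝ) * (N + 1)) • L := by
  have hcoeff : ∀ (p : ℝ[X]) (m : ℕ), (derivative ((X ^ 2 - 1) * derivative p)).coeff m =
      (m * (m + 1)) * p.coeff m - (m + 2) * (m + 1) * p.coeff (m + 2) := by
    intro p m
    rw [coeff_derivative, sub_mul, one_mul, coeff_sub, coeff_derivative]
    rcases m with _ | m
    · simp [pow_two, mul_assoc]; ring
    · rw [show m + 1 + 1 = m + 2 from rfl, coeff_X_pow_mul, coeff_derivative]
      push_cast; ring
  set q := derivative ((X ^ 2 - 1) * derivative L) - ((N : ℝ) * (N + 1)) • L with hq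
  have hqdeg : q.degree < N := by
    rw [degree_lt_iff_coeff_zero]
    intro m hm
    rw [hq, coeff_sub, hcoeff, coeff_smul, smul_eq_mul,
      coeff_eq_zero_of_natDegree_lt (hdeg.trans_lt (show N < m + 2 by omega))]
    rcases hm.eq_or_lt with h | h
    · rw [h]; ring
    · rw [coeff_eq_zero_of_natDegree_lt (hdeg.trans_lt h)]; ring
  have hopdeg : (derivative ((X ^ 2 - 1) * derivative q)).degree < N := by
    rw [degree_lt_iff_coeff_zero] at hqdeg ⊢
    intro m hm
    rw [hcoeff, hqdeg m hm, hqdeg (m + 2) (by omega)]; ring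
  have hsymm : polyInner (derivative ((X ^ 2 - 1) * derivative L)) q =
      polyInner L (derivative ((X ^ 2 - 1) * derivative q)) := by
    rw [polyInner_derivative_left, polyInner_mul_left, polyInner_derivative_left]
    simp
  have hqq : polyInner q q = 0 := by
    calc polyInner q q = polyInner (derivative ((X ^ 2 - 1) * derivative L)) q -
          polyInner (((N : ℝ) * (N + 1)) • L) q := by
            rw [← LinearMap.sub_apply, ← map_sub]
      _ = 0 := by
        rw [hsymm, horth _ hopdeg, map_smul, LinearMap.smul_apply, horth _ hqdeg]
        simp
  exact sub_eq_zero.1 (eq_zero_of_polyInner_self hqq)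

lemma polyInner_derivative_of_orthogonal {N : ℕ} {L : ℝ[X]} (hdeg : L.natDegree ≤ N)
    (horth : ∀ q : ℝ[X], q.degree < N → polyInner L q = 0) :
    polyInner (derivative L) (derivative L) =
      (N * (N + 1) * (2 * N + 1) / 2 : ℝ) * polyInner L L := by
  have hode := legendre_ode_of_orthogonal hdeg horth
  have h0 : polyInner L (derivative (derivative L)) = 0 := by
    refine horth _ ?_
    rw [degree_lt_iff_coeff_zero]
    intro m hm
    rw [coeff_derivative, coeff_derivative,
      coeff_eq_zero_of_natDegree_lt (hdeg.trans_lt (show N < m + 1 + 1 by omega))]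
    ring
  have h1 := congrArg (eval 1) hode
  have h2 := congrArg (eval (-1)) hode
  have h3 := eval_sq_add_eval_sq_of_orthogonal hdeg horth
  simp [derivative_mul] at h1 h2
  rw [polyInner_derivative_left, h0]
  linear_combination L.eval 1 / 2 * h1 + L.eval (-1) / 2 * h2 + (N * (N + 1) / 2 : ℝ) * h3

/-- **Markov's inequality** in `L²[-1, 1]`. The constant is the sum over `k ≤ N` of the ratios
`k (k + 1) (2 k + 1) / 2` of the Legendre polynomials. -/
lemma polyInner_derivative_le (N : ℕ) (p : ℝ[X]) (hp : p.natDegree ≤ N) :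
    polyInner (derivative p) (derivative p) ≤
      (N * (N + 1) ^ 2 * (N + 2) / 4 : ℝ) * polyInner p p := by
  induction N generalizing p with
  | zero =>
    rw [eq_C_of_natDegree_le_zero hp]
    simp
  | succ N ih =>
    obtain ⟨L, hLdeg, hL1, horth⟩ := exists_monic_orthogonal (N + 1)
    obtain ⟨a, q, hq, rfl⟩ : ∃ (a : ℝ) (q : ℝ[X]), q.degree < (N + 1 : ℕ) ∧ p = q + a • L := by
      refine ⟨p.coeff (N + 1), p - p.coeff (N + 1) • L, ?_, by simp⟩
      rw [degree_lt_iff_coeff_zero]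
      intro m hm
      rcases hm.eq_or_lt with h | h
      · rw [← h]; simp [hL1]
      · simp [coeff_eq_zero_of_natDegree_lt (hp.trans_lt h),
          coeff_eq_zero_of_natDegree_lt (hLdeg.trans_lt h)]
    have hq' := ih q (natDegree_le_iff_coeff_eq_zero.2 fun m hm =>
      (degree_lt_iff_coeff_zero _ _).1 hq m hm)
    have hL' := polyInner_derivative_of_orthogonal hLdeg horth
    have hLq := horth q hq
    have hqL : polyInner q L = 0 := by rw [polyInner_comm, hLq]
    have hcs := polyInner_sq_le (derivative q) (derivative L)
    have hc := polyInner_comm (derivative L) (derivative q)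
    have hA := polyInner_self_nonneg q
    have hA' := polyInner_self_nonneg (derivative q)
    have hD := polyInner_self_nonneg L
    simp only [map_add, map_smul, LinearMap.add_apply,
      LinearMap.smul_apply, smul_eq_mul, hqL, hLq, hc]
    rw [hL'] at hcs ⊢
    generalize polyInner (derivative q) (derivative L) = c at *
    generalize polyInner (derivative q) (derivative q) = A' at *
    generalize polyInner q q = A at *
    generalize polyInner L L = D at *
    set B : ℝ := N * (N + 1) ^ 2 * (N + 2) / 4 with hB
    set b : ℝ := (↑(N + 1) * (↑(N + 1) + 1) * (2 * ↑(N + 1) + 1) / 2) with hb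
    have hB0 : 0 ≤ B := by positivity
    have hb0 : 0 ≤ b := by positivity
    have hBb : (↑(N + 1) * (↑(N + 1) + 1) ^ 2 * (↑(N + 1) + 2) / 4 : ℝ) = B + b := by
      rw [hB, hb]; push_cast; ring
    rw [hBb]
    have key : 2 * (a * c) ≤ b * A + B * (a ^ 2 * D) := by
      refine le_of_abs_le (abs_le_of_sq_le_sq ?_ (by positivity))
      have h1 : c ^ 2 ≤ (B * A) * (b * D) :=
        hcs.trans (mul_le_mul_of_nonneg_right hq' (by positivity))
      nlinarith [sq_nonneg (b * A - B * (a ^ 2 * D)), mul_le_mul_of_nonneg_left h1 (sq_nonneg a)]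
    nlinarith

/-! ### The trapezoidal rule for squares of polynomials -/

/-- The trapezoidal rule on one interval, with its error bounded by the variation of `f`. -/
lemma integral_le_trapezoid {f f' : ℝ → ℝ} {a b : ℝ} (hab : a ≤ b)
    (hf : ∀ x, HasDerivAt f (f' x) x) (hf' : Continuous f') :
    ∫ x in a..b, f x ≤
      (b - a) / 2 * (f a + f b) + (b - a) / 2 * ∫ x in a..b, |f' x| := by
  have hd : ∀ x ∈ Set.uIcc a b, HasDerivAt (fun x : ℝ => x - (a + b) / 2) 1 x :=
    fun x _ => (hasDerivAt_id x).sub_const _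
  have hparts := integral_mul_deriv_eq_deriv_mul (fun x _ => hf x) hd
    (hf'.intervalIntegrable a b) (continuous_const.intervalIntegrable a b)
  have hbound : |∫ x in a..b, f' x * (x - (a + b) / 2)| ≤
      ∫ x in a..b, (b - a) / 2 * |f' x| := by
    refine (abs_integral_le_integral_abs hab).trans
      (integral_mono_on hab (Continuous.intervalIntegrable (by fun_prop) _ _)
        (Continuous.intervalIntegrable (by fun_prop) _ _) fun x hx => ?_)
    rw [abs_mul, mul_comm]
    gcongr
    rw [abs_le]
    constructor <;> linarith [hx.1, hx.2]
  rw [integral_const_mul] at hbound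
  simp only [mul_one] at hparts
  have := (abs_le.1 hbound).1
  rw [hparts]
  linarith

/-- The composite trapezoidal rule with `N` equal steps on `[-1, 1]`, for a nonnegative function. -/
lemma integral_le_sum_of_nonneg {f f' : ℝ → ℝ} {N : ℕ} (hN : N ≠ 0)
    (hf : ∀ x, HasDerivAt f (f' x) x) (hf' : Continuous f') (hpos : ∀ x, 0 ≤ f x) :
    ∫ x in (-1 : ℝ)..1, f x ≤
      2 / N * ∑ k ∈ Finset.range (N + 1), f (-1 + k * (2 / N)) +
        1 / N * ∫ x in (-1 : ℝ)..1, |f' x| := by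
  have hN' : (0 : ℝ) < N := by positivity
  have hfc : Continuous f := continuous_iff_continuousAt.2 fun x => (hf x).continuousAt
  set a : ℕ → ℝ := fun k => -1 + k * (2 / N) with ha
  have ha0 : a 0 = -1 := by simp [ha]
  have haN : a N = 1 := by simp only [ha]; field_simp; norm_num
  have hstep : ∀ k, a (k + 1) - a k = 2 / N := fun k => by simp only [ha]; push_cast; ring
  have h1 := sum_integral_adjacent_intervals (a := a) (n := N) (μ := MeasureTheory.volume)
    fun k _ => hfc.intervalIntegrable _ _
  have h2 := sum_integral_adjacent_intervals (a := a) (n := N) (μ := MeasureTheory.volume)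
    fun k _ => hf'.abs.intervalIntegrable _ _
  rw [ha0, haN] at h1 h2
  have hcell : ∀ k ∈ Finset.range N, ∫ x in a k..a (k + 1), f x ≤
      1 / N * (f (a k) + f (a (k + 1))) + 1 / N * ∫ x in a k..a (k + 1), |f' x| := by
    intro k _
    have := integral_le_trapezoid (a := a k) (b := a (k + 1))
      (sub_nonneg.1 (by rw [hstep]; positivity)) hf hf'
    rwa [hstep, show (2 / N / 2 : ℝ) = 1 / N by ring] at this
  have hsum := Finset.sum_le_sum hcell
  rw [h1, Finset.sum_add_distrib, ← Finset.mul_sum, ← Finset.mul_sum, h2,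
    Finset.sum_add_distrib] at hsum
  have e1 := Finset.sum_range_succ (fun k => f (a k)) N
  have e2 := Finset.sum_range_succ' (fun k => f (a k)) N
  have hle : 1 / N * (∑ k ∈ Finset.range N, f (a k) + ∑ k ∈ Finset.range N, f (a (k + 1))) ≤
      2 / N * ∑ k ∈ Finset.range (N + 1), f (a k) := by
    rw [show (2 / N : ℝ) = 1 / N * 2 by ring, mul_assoc]
    gcongr
    linarith [hpos (a 0), hpos (a N)]
  linarith

/-- On a mesh with at least `4 R²` cells, the mean square of a polynomial of degree at most `R` over
the nodes dominates a fixed multiple of its mean square over `[-1, 1]`: the error of the trapezoidal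
rule is at most `(1 / N) ∫ |2 p p'|`, which Markov's inequality bounds by `0.867 ∫ p²`, where `0.867`
exceeds `√3 / 2` slightly. -/
lemma polyInner_self_le_sum_sq {N R : ℕ} (hN : N ≠ 0) (hR : 4 * R ^ 2 ≤ N) (p : ℝ[X])
    (hp : p.natDegree ≤ R) :
    133 / 1000 * polyInner p p ≤
      2 / N * ∑ k ∈ Finset.range (N + 1), p.eval (-1 + k * (2 / N) : ℝ) ^ 2 := by
  have hN' : (0 : ℝ) < N := by positivity
  have hR' : (4 * R ^ 2 : ℝ) ≤ N := by exact_mod_cast hR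
  have htrap := integral_le_sum_of_nonneg (f := fun x => p.eval x ^ 2)
    (f' := fun x => 2 * p.eval x * (derivative p).eval x) hN
    (fun x => by simpa using! (p.hasDerivAt x).pow 2) (by fun_prop) (fun x => sq_nonneg _)
  have hI : ∫ x in (-1 : ℝ)..1, p.eval x ^ 2 = polyInner p p := by
    simp [polyInner_apply, sq]
  have hA := polyInner_self_nonneg p
  have hmarkov := polyInner_derivative_le R p hp
  have hvar : ∫ x in (-1 : ℝ)..1, |2 * p.eval x * (derivative p).eval x| ≤
      867 / 1000 * N * polyInner p p := by
    rcases R.eq_zero_or_pos with rfl | hRpos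
    · rw [eq_C_of_natDegree_le_zero hp]
      simp only [derivative_C, eval_zero, mul_zero, abs_zero, integral_zero]
      exact mul_nonneg (by positivity) (polyInner_self_nonneg _)
    -- the weight `s` is close to the Markov constant `√3 R²` of the worst case `R = 1`
    set s : ℝ := 7 / 4 * R ^ 2 with hs
    have hR1 : (1 : ℝ) ≤ R := by exact_mod_cast hRpos
    have hs0 : 0 < s := by positivity
    have hpt : ∀ x, |2 * p.eval x * (derivative p).eval x| ≤
        s * (p.eval x * p.eval x) +
          s⁻¹ * ((derivative p).eval x * (derivative p).eval x) := by
      intro x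
      have h1 : 0 ≤ s⁻¹ * (s * |p.eval x| - |(derivative p).eval x|) ^ 2 := by positivity
      have h2 : s⁻¹ * (s * |p.eval x| - |(derivative p).eval x|) ^ 2 =
          s * (|p.eval x| * |p.eval x|) - 2 * |p.eval x| * |(derivative p).eval x| +
            s⁻¹ * (|(derivative p).eval x| * |(derivative p).eval x|) := by
        field_simp; ring
      rw [abs_mul, abs_mul, abs_two]
      rw [h2, abs_mul_abs_self, abs_mul_abs_self] at h1
      linarith
    have hint : ∫ x in (-1 : ℝ)..1, |2 * p.eval x * (derivative p).eval x| ≤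
        s * polyInner p p + s⁻¹ * polyInner (derivative p) (derivative p) := by
      rw [polyInner_apply, polyInner_apply, ← integral_const_mul, ← integral_const_mul,
        ← integral_add (Continuous.intervalIntegrable (by fun_prop) _ _)
          (Continuous.intervalIntegrable (by fun_prop) _ _)]
      exact integral_mono_on (by norm_num) (Continuous.intervalIntegrable (by fun_prop) _ _)
        (Continuous.intervalIntegrable (by fun_prop) _ _) fun x _ => hpt x
    have hB : (R * (R + 1) ^ 2 * (R + 2) / 4 : ℝ) ≤ 3 * R ^ 4 := by
      have : ((R : ℝ) + 1) ^ 2 * (R + 2) ≤ 12 * (R : ℝ) ^ 3 := by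
        calc ((R : ℝ) + 1) ^ 2 * (R + 2) ≤ ((R : ℝ) + R) ^ 2 * (R + 2 * R) := by gcongr; linarith
          _ = 12 * (R : ℝ) ^ 3 := by ring
      nlinarith
    have hsB : s⁻¹ * (3 * (R : ℝ) ^ 4) = 12 / 7 * R ^ 2 := by
      rw [hs]; field_simp; ring
    calc _ ≤ s * polyInner p p + s⁻¹ * (3 * R ^ 4 * polyInner p p) := by
          refine hint.trans ?_
          gcongr
          exact hmarkov.trans (by gcongr)
      _ = (7 / 4 + 12 / 7) * R ^ 2 * polyInner p p := by
          rw [← mul_assoc s⁻¹, hsB, hs]; ring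
      _ ≤ 867 / 1000 * N * polyInner p p := by
          refine mul_le_mul_of_nonneg_right ?_ hA
          linarith
  rw [hI] at htrap
  have : 1 / N * ∫ x in (-1 : ℝ)..1, |2 * p.eval x * (derivative p).eval x| ≤
      867 / 1000 * polyInner p p := by
    calc _ ≤ 1 / N * (867 / 1000 * N * polyInner p p) := by gcongr
      _ = _ := by field_simp
  linarith

/-! ### Chebyshev sums: coefficients, integrals and equispaced samples -/

/-- The polynomial with given coefficients in the Chebyshev basis. -/
def chebSum {F : Type*} [Field F] {R : ℕ} (c : Fin (R + 1) → F) : F[X] :=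
  ∑ j, C (c j) * Chebyshev.T F ((j : ℕ) : ℤ)

lemma eval_chebSum {F : Type*} [Field F] {R : ℕ} (c : Fin (R + 1) → F) (x : F) :
    (chebSum c).eval x = ∑ j, c j * (Chebyshev.T F ((j : ℕ) : ℤ)).eval x := by
  simp [chebSum, eval_finsetSum]

lemma natDegree_chebSum_le {F : Type*} [Field F] [CharZero F] {R : ℕ} (c : Fin (R + 1) → F) :
    (chebSum c).natDegree ≤ R := by
  refine natDegree_sum_le_of_forall_le _ _ fun j _ => ?_
  refine (natDegree_C_mul_le _ _).trans ?_
  rw [Chebyshev.natDegree_T, Int.natAbs_natCast]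
  omega

lemma eval_chebSum_sq_le {R : ℕ} (c : Fin (R + 1) → ℝ) {x : ℝ} (hx : |x| ≤ 1) :
    (chebSum c).eval x ^ 2 ≤ (R + 1) * ∑ j, c j ^ 2 := by
  rw [eval_chebSum]
  refine (Finset.sum_mul_sq_le_sq_mul_sq _ _ _).trans ?_
  rw [mul_comm]
  refine mul_le_mul_of_nonneg_right ?_ (Finset.sum_nonneg fun j _ => sq_nonneg _)
  calc ∑ j : Fin (R + 1), (Chebyshev.T ℝ ((j : ℕ) : ℤ)).eval x ^ 2
      ≤ ∑ _j : Fin (R + 1), (1 : ℝ) := by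
        gcongr with j
        exact (sq_le_one_iff_abs_le_one _).2 (Chebyshev.abs_eval_T_real_le_one _ hx)
    _ = R + 1 := by simp

/-- Orthogonality of the Chebyshev polynomials for the weight `(1 - x²)^(-1/2)`. -/
lemma pi_div_two_mul_sum_sq_le_integral {R : ℕ} (c : Fin (R + 1) → ℝ) :
    Real.pi / 2 * ∑ j, c j ^ 2 ≤ ∫ θ in (0 : ℝ)..Real.pi, (chebSum c).eval (Real.cos θ) ^ 2 := by
  rw [← Chebyshev.integral_measureT_eq_integral_cos (f := fun x => (chebSum c).eval x ^ 2)]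
  have hexp : ∀ x : ℝ, (chebSum c).eval x ^ 2 = ∑ i, ∑ j, c i * c j *
      ((Chebyshev.T ℝ ((i : ℕ) : ℤ)).eval x * (Chebyshev.T ℝ ((j : ℕ) : ℤ)).eval x) := by
    intro x
    rw [eval_chebSum, sq, Finset.sum_mul_sum]
    exact Finset.sum_congr rfl fun i _ => Finset.sum_congr rfl fun j _ => by ring
  have hint : ∀ i j : Fin (R + 1), MeasureTheory.Integrable (fun x : ℝ => c i * c j *
      ((Chebyshev.T ℝ ((i : ℕ) : ℤ)).eval x * (Chebyshev.T ℝ ((j : ℕ) : ℤ)).eval x))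
      Chebyshev.measureT := fun i j =>
    Chebyshev.integrable_measureT (Continuous.continuousOn (by fun_prop))
  simp_rw [hexp]
  rw [MeasureTheory.integral_finsetSum _ fun i _ => MeasureTheory.integrable_finsetSum _
    fun j _ => hint i j, Finset.mul_sum]
  refine Finset.sum_le_sum fun i _ => ?_
  rw [MeasureTheory.integral_finsetSum _ fun j _ => hint i j, Finset.sum_eq_single i]
  · rw [MeasureTheory.integral_const_mul, ← sq, mul_comm]
    refine mul_le_mul_of_nonneg_left ?_ (sq_nonneg _)
    rcases eq_or_ne (i : ℕ) 0 with h | h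
    · rw [h, Nat.cast_zero, Chebyshev.integral_eval_T_real_mul_self_measureT_zero]
      linarith [Real.pi_pos]
    · rw [Chebyshev.integral_T_real_mul_self_measureT_of_ne_zero h]
  · intro j _ hj
    rw [MeasureTheory.integral_const_mul,
      Chebyshev.integral_eval_T_real_mul_eval_T_real_measureT_of_ne
        (fun h => hj (Fin.ext h.symm)), mul_zero]
  · simp

/-- The unweighted integral of `p²` loses at most a factor of the order `R` against the Chebyshev
coefficients. With `x = cos θ` the integrand is `p(cos θ)² sin θ`, where `sin θ` is at least of the
order `1 / R` off two end intervals of length `π / (8 (R + 1))`; these carry at most half of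
`∫ p(cos θ)²`, as `p² ≤ (R + 1) ∑ c_j²`. -/
lemma sum_sq_le_polyInner_chebSum {R : ℕ} (c : Fin (R + 1) → ℝ) :
    Real.pi / (16 * (R + 1)) * ∑ j, c j ^ 2 ≤ polyInner (chebSum c) (chebSum c) := by
  set S := ∑ j, c j ^ 2 with hS
  have hS0 : 0 ≤ S := Finset.sum_nonneg fun j _ => sq_nonneg _
  have hpi := Real.pi_pos
  set p := chebSum c
  set δ : ℝ := Real.pi / (8 * (R + 1)) with hδ
  have hδ0 : 0 < δ := by positivity
  have hδle : δ ≤ Real.pi / 8 := by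
    rw [hδ]; gcongr; linarith [(Nat.cast_nonneg R : (0 : ℝ) ≤ R)]
  have hsubst : polyInner p p =
      ∫ θ in (0 : ℝ)..Real.pi, p.eval (Real.cos θ) ^ 2 * Real.sin θ := by
    have h := integral_comp_mul_deriv (a := 0) (b := Real.pi) (f := Real.cos)
      (f' := fun θ => -Real.sin θ) (g := fun x => p.eval x * p.eval x)
      (fun x _ => Real.hasDerivAt_cos x) (by fun_prop) (by fun_prop)
    rw [Real.cos_zero, Real.cos_pi, integral_symm (-1)] at h
    rw [polyInner_apply, eq_comm, ← neg_inj, ← h, ← integral_neg]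
    exact integral_congr fun θ _ => by simp only [Function.comp]; ring
  have hi : ∀ a b : ℝ, IntervalIntegrable (fun θ => p.eval (Real.cos θ) ^ 2)
      MeasureTheory.volume a b := fun a b => Continuous.intervalIntegrable (by fun_prop) _ _
  have his : ∀ a b : ℝ, IntervalIntegrable (fun θ => p.eval (Real.cos θ) ^ 2 * Real.sin θ)
      MeasureTheory.volume a b := fun a b => Continuous.intervalIntegrable (by fun_prop) _ _
  have hend : ∀ a : ℝ, ∫ θ in a..a + δ, p.eval (Real.cos θ) ^ 2 ≤ δ * ((R + 1) * S) := by
    intro a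
    calc ∫ θ in a..a + δ, p.eval (Real.cos θ) ^ 2
        ≤ ∫ _θ in a..a + δ, (R + 1) * S :=
          integral_mono_on (by linarith) (hi _ _) (by simp) fun θ _ =>
            eval_chebSum_sq_le c (Real.abs_cos_le_one θ)
      _ = δ * ((R + 1) * S) := by simp; ring
  have hδS : δ * ((R + 1) * S) = Real.pi / 8 * S := by rw [hδ]; field_simp
  have hmid : Real.pi / 4 * S ≤ ∫ θ in δ..Real.pi - δ, p.eval (Real.cos θ) ^ 2 := by
    have htot := pi_div_two_mul_sum_sq_le_integral c
    have h1 := integral_add_adjacent_intervals (hi 0 δ) (hi δ (Real.pi - δ))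
    have h2 := integral_add_adjacent_intervals (hi 0 (Real.pi - δ)) (hi (Real.pi - δ) Real.pi)
    have e1 := hend 0
    have e2 := hend (Real.pi - δ)
    rw [zero_add] at e1
    rw [sub_add_cancel] at e2
    rw [hδS] at e1 e2
    linarith
  have hsin : ∀ θ ∈ Set.Icc δ (Real.pi - δ), 1 / (4 * (R + 1)) ≤ Real.sin θ := by
    have hδ' : 2 / Real.pi * δ = 1 / (4 * (R + 1)) := by rw [hδ]; field_simp; norm_num
    intro θ hθ
    rw [← hδ']
    rcases le_total θ (Real.pi / 2) with h | h
    · exact (mul_le_mul_of_nonneg_left hθ.1 (by positivity)).trans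
        (Real.mul_le_sin (hδ0.le.trans hθ.1) h)
    · rw [← Real.sin_pi_sub]
      exact (mul_le_mul_of_nonneg_left (by linarith [hθ.2]) (by positivity)).trans
        (Real.mul_le_sin (by linarith [hθ.2]) (by linarith))
  have hsin0 : ∀ θ ∈ Set.Icc 0 Real.pi, 0 ≤ p.eval (Real.cos θ) ^ 2 * Real.sin θ :=
    fun θ hθ => mul_nonneg (sq_nonneg _) (Real.sin_nonneg_of_mem_Icc hθ)
  calc Real.pi / (16 * (R + 1)) * S
      = 1 / (4 * (R + 1)) * (Real.pi / 4 * S) := by field_simp; ring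
    _ ≤ 1 / (4 * (R + 1)) * ∫ θ in δ..Real.pi - δ, p.eval (Real.cos θ) ^ 2 := by gcongr
    _ = ∫ θ in δ..Real.pi - δ, p.eval (Real.cos θ) ^ 2 * (1 / (4 * (R + 1))) := by
        rw [integral_mul_const, mul_comm]
    _ ≤ ∫ θ in δ..Real.pi - δ, p.eval (Real.cos θ) ^ 2 * Real.sin θ := by
        refine integral_mono_on (by linarith) (Continuous.intervalIntegrable (by fun_prop) _ _)
          (his _ _) fun θ hθ => ?_
        exact mul_le_mul_of_nonneg_left (hsin θ hθ) (sq_nonneg _)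
    _ ≤ ∫ θ in (0 : ℝ)..Real.pi, p.eval (Real.cos θ) ^ 2 * Real.sin θ := by
        have h1 := integral_add_adjacent_intervals (his 0 δ) (his δ (Real.pi - δ))
        have h2 := integral_add_adjacent_intervals (his 0 (Real.pi - δ)) (his (Real.pi - δ) Real.pi)
        have e1 : 0 ≤ ∫ θ in (0 : ℝ)..δ, p.eval (Real.cos θ) ^ 2 * Real.sin θ :=
          integral_nonneg hδ0.le fun θ hθ => hsin0 θ ⟨hθ.1, by linarith [hθ.2]⟩
        have e2 : 0 ≤ ∫ θ in (Real.pi - δ)..Real.pi, p.eval (Real.cos θ) ^ 2 * Real.sin θ :=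
          integral_nonneg (by linarith) fun θ hθ => hsin0 θ ⟨by linarith [hθ.1], hθ.2⟩
        linarith
    _ = polyInner p p := hsubst.symm

/-- The lower bound `2 (M - 1) / (125 (2 R + 1))` for the square of the smallest singular value of
the matrix `chebMatrix M R`, for real coefficients. -/
lemma sum_sq_le_sum_eval_sq {M R : ℕ} (hM : 2 ≤ M) (hR : (R : ℝ) ≤ 1 / 2 * √((M : ℝ) - 1))
    (c : Fin (R + 1) → ℝ) :
    2 * ((M : ℝ) - 1) / (125 * (2 * R + 1)) * ∑ j, c j ^ 2 ≤
      ∑ k : Fin M, (chebSum c).eval (equiPoint M k) ^ 2 := by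
  obtain ⟨N, rfl⟩ : ∃ N, M = N + 1 := ⟨M - 1, by omega⟩
  have hN : N ≠ 0 := by omega
  have hcast : ((N + 1 : ℕ) : ℝ) - 1 = N := by push_cast; ring
  have hN' : (0 : ℝ) < N := by positivity
  rw [hcast] at hR ⊢
  have hR4 : 4 * R ^ 2 ≤ N := by
    have : (4 * R ^ 2 : ℝ) ≤ N := by
      have h1 : ((R : ℝ)) ^ 2 ≤ (1 / 2 * √(N : ℝ)) ^ 2 := by gcongr
      rw [mul_pow, Real.sq_sqrt hN'.le] at h1
      linarith
    exact_mod_cast this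
  rcases R.eq_zero_or_pos with rfl | hRpos
  · have heval : ∀ x, (chebSum c).eval x = c 0 := fun x => by
      rw [eval_chebSum, Fin.sum_univ_succ]; simp
    simp only [heval, Finset.sum_const, Finset.card_univ, Fintype.card_fin,
      nsmul_eq_mul, Fin.sum_univ_succ (fun j => c j ^ 2), Finset.univ_eq_empty, Finset.sum_empty]
    push_cast
    nlinarith [sq_nonneg (c 0)]
  have hR1 : (1 : ℝ) ≤ R := by exact_mod_cast hRpos
  have h1 := polyInner_self_le_sum_sq hN hR4 (chebSum c) (natDegree_chebSum_le c)
  have h2 := sum_sq_le_polyInner_chebSum c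
  have hS0 : 0 ≤ ∑ j, c j ^ 2 := Finset.sum_nonneg fun j _ => sq_nonneg _
  have hsum : ∑ k : Fin (N + 1), (chebSum c).eval (equiPoint (N + 1) k) ^ 2 =
      ∑ k ∈ Finset.range (N + 1), (chebSum c).eval (-1 + k * (2 / N) : ℝ) ^ 2 := by
    rw [← Fin.sum_univ_eq_sum_range (fun k => (chebSum c).eval (-1 + k * (2 / N) : ℝ) ^ 2)]
    simp only [equiPoint, hcast]
  rw [hsum]
  generalize ∑ k ∈ Finset.range (N + 1), (chebSum c).eval (-1 + k * (2 / N) : ℝ) ^ 2 = Y at *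
  generalize polyInner (chebSum c) (chebSum c) = I at *
  generalize ∑ j, c j ^ 2 = S at *
  have hY : N / 2 * (133 / 1000 * I) ≤ Y := by
    calc N / 2 * (133 / 1000 * I) ≤ N / 2 * (2 / N * Y) := by gcongr
      _ = Y := by field_simp
  refine le_trans ?_ hY
  calc 2 * (N : ℝ) / (125 * (2 * R + 1)) * S
      = N / 2 * (4 / (125 * (2 * R + 1)) * S) := by ring
    _ ≤ N / 2 * (133 / 1000 * (Real.pi / (16 * (R + 1)) * S)) := by
        rw [← mul_assoc (133 / 1000 : ℝ)]
        gcongr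
        rw [mul_div_assoc', div_le_div_iff₀ (by positivity) (by positivity)]
        nlinarith [Real.pi_gt_d2]
    _ ≤ N / 2 * (133 / 1000 * I) := by gcongr

end ChebExtrapolation
end

noncomputable section
namespace ChebExtrapolation

open Polynomial Metric

/-! ### The Chebyshev expansion on a Bernstein ellipse -/

/-- The Joukowski map `w ↦ (w + w⁻¹) / 2`; it maps the circle of radius `s > 1` onto the boundary of
the Bernstein ellipse with parameter `s`. -/
def joukowski (w : ℂ) : ℂ := (w + w⁻¹) / 2

lemma joukowski_inv (w : ℂ) : joukowski w⁻¹ = joukowski w := by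
  simp [joukowski, add_comm]

lemma norm_joukowski_sub_add_norm {w : ℂ} (hw : w ≠ 0) :
    ‖joukowski w - 1‖ + ‖joukowski w + 1‖ = ‖w‖ + ‖w‖⁻¹ := by
  have h1 : joukowski w - 1 = (w - 1) ^ 2 / (2 * w) := by simp only [joukowski]; field_simp; ring
  have h2 : joukowski w + 1 = (w + 1) ^ 2 / (2 * w) := by simp only [joukowski]; field_simp; ring
  have hw' : ‖w‖ ≠ 0 := norm_ne_zero_iff.2 hw
  have hpar := parallelogram_law_with_norm ℝ w 1
  rw [norm_one] at hpar
  rw [h1, h2, norm_div, norm_div, norm_pow, norm_pow, norm_mul, Complex.norm_ofNat, ← add_div]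
  field_simp
  linarith

/-- The function `s ↦ s + s⁻¹` is increasing on `[1, ∞)`. -/
lemma add_inv_lt_add_inv {s ρ : ℝ} (hs : 1 ≤ s) (h : s < ρ) : s + s⁻¹ < ρ + ρ⁻¹ := by
  have hs0 : 0 < s := by linarith
  have hρ0 : 0 < ρ := by linarith
  have : ρ + ρ⁻¹ - (s + s⁻¹) = (ρ - s) * (1 - (ρ * s)⁻¹) := by field_simp; ring
  have h1 : (ρ * s)⁻¹ < 1 := inv_lt_one_of_one_lt₀ (by nlinarith)
  nlinarith [mul_pos (sub_pos.2 h) (sub_pos.2 h1)]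

lemma joukowski_mem_bernsteinEllipse {ρ : ℝ} {w : ℂ} (h1 : 1 ≤ ‖w‖) (h2 : ‖w‖ < ρ) :
    joukowski w ∈ bernsteinEllipse ρ := by
  have hw : w ≠ 0 := norm_pos_iff.1 (by linarith)
  simpa only [bernsteinEllipse, Set.mem_ofPred_eq, norm_joukowski_sub_add_norm hw] using
    add_inv_lt_add_inv h1 h2

lemma joukowski_mem_bernsteinBoundary {w : ℂ} (hw : w ≠ 0) :
    joukowski w ∈ bernsteinBoundary ‖w‖ := norm_joukowski_sub_add_norm hw

lemma joukowski_mem_closedBernsteinEllipse {ρ : ℝ} {w : ℂ} (h1 : 1 ≤ ‖w‖) (h2 : ‖w‖ ≤ ρ) :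
    joukowski w ∈ closedBernsteinEllipse ρ := by
  rcases h2.eq_or_lt with rfl | h
  · exact le_of_eq (norm_joukowski_sub_add_norm (norm_pos_iff.1 (by linarith)))
  · exact le_of_lt (Set.mem_ofPred.1 (joukowski_mem_bernsteinEllipse h1 h))

lemma differentiableAt_joukowski {w : ℂ} (hw : w ≠ 0) : DifferentiableAt ℂ joukowski w := by
  unfold joukowski
  fun_prop (disch := exact hw)

lemma eval_T_joukowski (n : ℕ) {w : ℂ} (hw : w ≠ 0) :
    (Chebyshev.T ℂ n).eval (joukowski w) = (w ^ n + (w ^ n)⁻¹) / 2 := by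
  have h : joukowski w = Complex.cosh (Complex.log w) := by
    rw [joukowski, Complex.cosh, Complex.exp_neg, Complex.exp_log hw]
  rw [h, Chebyshev.T_complex_cosh, Complex.cosh, Complex.exp_neg, Int.cast_natCast,
    Complex.exp_nat_mul, Complex.exp_log hw]

lemma norm_eval_T_joukowski_le (n : ℕ) {w : ℂ} (hw : 1 ≤ ‖w‖) :
    ‖(Chebyshev.T ℂ n).eval (joukowski w)‖ ≤ ‖w‖ ^ n := by
  rw [eval_T_joukowski _ (norm_pos_iff.1 (by linarith)), norm_div, Complex.norm_ofNat,
    div_le_iff₀ two_pos]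
  refine (norm_add_le _ _).trans ?_
  rw [norm_inv, norm_pow]
  have h1 : 1 ≤ ‖w‖ ^ n := one_le_pow₀ hw
  linarith [inv_le_one_of_one_le₀ h1]

/-- The `n`-th Laurent coefficient of `w ↦ f ((w + w⁻¹) / 2)`, as an integral over the circle of
radius `s`. -/
def laurentCoeff (f : ℂ → ℂ) (s : ℝ) (n : ℤ) : ℂ :=
  (2 * Real.pi * Complex.I : ℂ)⁻¹ • ∮ z in C(0, s), z ^ (-n - 1) • f (joukowski z)

section Coefficients

variable {f : ℂ → ℂ} {ρ : ℝ}

/-- The Laurent coefficients do not depend on the radius, by Cauchy's theorem in an annulus. The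
unit circle may serve as the inner one, because it is mapped into the open ellipse. -/
lemma laurentCoeff_eq (hf : AnalyticOnEllipse ρ f) {s : ℝ} (hs : 1 ≤ s) (hsρ : s ≤ ρ) (n : ℤ) :
    laurentCoeff f s n = laurentCoeff f 1 n := by
  unfold laurentCoeff
  congr 1
  refine Complex.circleIntegral_eq_of_differentiable_on_annulus_off_countable one_pos hs
    Set.countable_empty ?_ ?_
  · intro z hz
    simp only [Set.mem_sdiff, mem_closedBall, mem_ball, dist_zero_right, not_lt] at hz
    have hz0 : z ≠ 0 := norm_pos_iff.1 (by linarith)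
    refine ContinuousWithinAt.smul
      (continuousAt_zpow₀ z _ (Or.inl hz0)).continuousWithinAt ?_
    refine ContinuousWithinAt.comp (t := closedBernsteinEllipse ρ)
      (hf.2 _ (joukowski_mem_closedBernsteinEllipse hz.2 (hz.1.trans hsρ)))
      (differentiableAt_joukowski hz0).continuousAt.continuousWithinAt ?_
    intro y hy
    simp only [Set.mem_sdiff, mem_closedBall, mem_ball, dist_zero_right, not_lt] at hy
    exact joukowski_mem_closedBernsteinEllipse hy.2 (hy.1.trans hsρ)
  · intro z hz
    simp only [Set.mem_sdiff, mem_closedBall, mem_ball, dist_zero_right, not_le,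
      Set.mem_empty_iff_false, not_false_eq_true, and_true] at hz
    have hz0 : z ≠ 0 := norm_pos_iff.1 (by linarith)
    refine DifferentiableAt.smul (differentiableAt_zpow.2 (Or.inl hz0)) ?_
    exact DifferentiableAt.comp z
      (hf.1 _ (joukowski_mem_bernsteinEllipse hz.2.le (by linarith))).differentiableAt
      (differentiableAt_joukowski hz0)

lemma laurentCoeff_eq_integral {s : ℝ} (hs : 0 < s) (n : ℤ) :
    laurentCoeff f s n * s ^ n = (2 * Real.pi : ℂ)⁻¹ *
      ∫ θ in (0 : ℝ)..2 * Real.pi, Complex.exp (-(n * θ * Complex.I)) *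
        f (joukowski (s * Complex.exp (θ * Complex.I))) := by
  have hs' : (s : ℂ) ≠ 0 := by exact_mod_cast hs.ne'
  rw [laurentCoeff, circleIntegral, smul_eq_mul, mul_right_comm,
    ← intervalIntegral.integral_const_mul, ← intervalIntegral.integral_const_mul]
  refine intervalIntegral.integral_congr fun θ _ => ?_
  have hexp : Complex.exp (-(n * θ * Complex.I)) = (Complex.exp (θ * Complex.I) ^ n)⁻¹ := by
    rw [Complex.exp_neg, ← Complex.exp_int_mul, mul_assoc]
  simp only [deriv_circleMap, circleMap, zero_add, smul_eq_mul]
  rw [hexp, zpow_sub_one₀ (by simp [hs']), zpow_neg, mul_zpow]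
  have := Complex.exp_ne_zero (θ * Complex.I)
  have hI := Complex.I_ne_zero
  have hpi : (Real.pi : ℂ) ≠ 0 := by exact_mod_cast Real.pi_ne_zero
  field_simp

lemma laurentCoeff_one_neg (n : ℤ) : laurentCoeff f 1 (-n) = laurentCoeff f 1 n := by
  have h1 := laurentCoeff_eq_integral (f := f) one_pos (-n)
  have h2 := laurentCoeff_eq_integral (f := f) one_pos n
  simp only [Complex.ofReal_one, one_zpow, mul_one, one_mul] at h1 h2
  rw [h1, h2]
  congr 1
  have hsub := intervalIntegral.integral_comp_sub_left (a := 0) (b := 2 * Real.pi)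
    (fun θ : ℝ => Complex.exp (-(n * θ * Complex.I)) *
      f (joukowski (Complex.exp (θ * Complex.I)))) (2 * Real.pi)
  rw [sub_self, sub_zero] at hsub
  rw [← hsub]
  refine intervalIntegral.integral_congr fun θ _ => ?_
  have e1 : Complex.exp (((2 * Real.pi - θ : ℝ) : ℂ) * Complex.I) =
      (Complex.exp (θ * Complex.I))⁻¹ := by
    rw [← Complex.exp_neg]
    push_cast
    rw [sub_mul, Complex.exp_sub, Complex.exp_two_pi_mul_I, one_div, Complex.exp_neg]
  have e2 : Complex.exp (-(n * ((2 * Real.pi - θ : ℝ) : ℂ) * Complex.I)) =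
      Complex.exp (-(((-n : ℤ) : ℂ) * θ * Complex.I)) := by
    rw [mul_assoc, Complex.exp_neg, Complex.exp_int_mul, e1, inv_zpow, inv_inv,
      ← Complex.exp_int_mul]
    congr 1
    push_cast; ring
  rw [e1, e2, joukowski_inv]

/-- Cauchy's estimate on the circle of radius `ρ`. -/
lemma norm_laurentCoeff_one_le (hρ : 1 < ρ) (hf : AnalyticOnEllipse ρ f) {K : ℝ}
    (hK : ∀ z ∈ bernsteinBoundary ρ, ‖f z‖ ≤ K) (n : ℕ) :
    ‖laurentCoeff f 1 n‖ ≤ K * ρ⁻¹ ^ n := by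
  have hρ0 : 0 < ρ := by linarith
  rw [← laurentCoeff_eq hf hρ.le le_rfl]
  refine (circleIntegral.norm_two_pi_i_inv_smul_integral_le_of_norm_le_const hρ0.le
    (C := ρ ^ (-(n : ℤ) - 1) * K) fun z hz => ?_).trans_eq ?_
  · have hz' : ‖z‖ = ρ := by simpa using hz
    have hz0 : z ≠ 0 := norm_pos_iff.1 (by linarith)
    rw [norm_smul, norm_zpow, hz']
    gcongr
    exact hK _ (hz' ▸ joukowski_mem_bernsteinBoundary hz0)
  · rw [zpow_sub_one₀ hρ0.ne', zpow_neg, zpow_natCast, inv_pow]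
    field_simp

/-- The Laurent expansion converges off the outer boundary: on the circle of radius `‖w‖` it is a
Fourier series with absolutely summable coefficients. -/
lemma hasSum_laurentCoeff (hρ : 1 < ρ) (hf : AnalyticOnEllipse ρ f) {K : ℝ}
    (hK : ∀ z ∈ bernsteinBoundary ρ, ‖f z‖ ≤ K) {w : ℂ} (hw1 : 1 ≤ ‖w‖) (hwρ : ‖w‖ < ρ) :
    HasSum (fun n : ℤ => laurentCoeff f 1 n * w ^ n) (f (joukowski w)) := by
  set s := ‖w‖ with hs
  have hs0 : 0 < s := by linarith
  have hsC : (s : ℂ) ≠ 0 := by exact_mod_cast hs0.ne'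
  have hρ0 : 0 < ρ := by linarith
  have : Fact (0 < 2 * Real.pi) := ⟨Real.two_pi_pos⟩
  have hnorm : ∀ x : AddCircle (2 * Real.pi), ‖(s : ℂ) * (AddCircle.toCircle x : ℂ)‖ = s := by
    intro x
    rw [norm_mul, Circle.norm_coe, mul_one, Complex.norm_real, Real.norm_of_nonneg hs0.le]
  let g : C(AddCircle (2 * Real.pi), ℂ) :=
    { toFun := fun x => f (joukowski (s * (AddCircle.toCircle x : ℂ)))
      continuous_toFun := by
        refine continuous_iff_continuousAt.2 fun x => ?_
        have hx := hnorm x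
        refine ContinuousAt.comp (g := f)
          (hf.1 _ (joukowski_mem_bernsteinEllipse (by rw [hx]; exact hw1)
            (by rw [hx]; exact hwρ))).continuousAt ?_
        refine ContinuousAt.comp (g := joukowski)
          (differentiableAt_joukowski (norm_pos_iff.1 (by rw [hx]; exact hs0))).continuousAt ?_
        exact (continuous_const.mul
          (continuous_subtype_val.comp AddCircle.continuous_toCircle)).continuousAt }
  have htoC : ∀ θ : ℝ, ((AddCircle.toCircle (θ : AddCircle (2 * Real.pi)) : Circle) : ℂ) =
      Complex.exp (θ * Complex.I) := by
    intro θ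
    rw [AddCircle.toCircle_apply_mk, Circle.coe_exp, div_self Real.two_pi_pos.ne', one_mul]
  have hfour : ∀ (n : ℤ) (θ : ℝ), fourier n (θ : AddCircle (2 * Real.pi)) =
      Complex.exp (n * θ * Complex.I) := by
    intro n θ
    rw [fourier_coe_apply]
    congr 1
    have hpi : (Real.pi : ℂ) ≠ 0 := by exact_mod_cast Real.pi_ne_zero
    push_cast
    field_simp
  have hcoeff : ∀ n : ℤ, fourierCoeff g n = laurentCoeff f 1 n * s ^ n := by
    intro n
    rw [← laurentCoeff_eq hf hw1 hwρ.le, laurentCoeff_eq_integral hs0,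
      fourierCoeff_eq_intervalIntegral _ _ 0, zero_add, Complex.real_smul]
    congr 1
    · push_cast; rw [one_div]
    · refine intervalIntegral.integral_congr fun θ _ => ?_
      simp only [hfour, smul_eq_mul, g, ContinuousMap.coe_mk, htoC]
      congr 2
      push_cast; ring
  have hpos := norm_laurentCoeff_one_le hρ hf hK
  have hsum : Summable (fourierCoeff g) := by
    refine Summable.of_nat_of_neg ?_ ?_
    · refine Summable.of_norm_bounded (g := fun n : ℕ => K * (s / ρ) ^ n)
        ((summable_geometric_of_lt_one (by positivity) ((div_lt_one hρ0).2 hwρ)).mul_left K)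
        fun n => ?_
      rw [hcoeff, norm_mul, zpow_natCast, norm_pow, Complex.norm_real, Real.norm_of_nonneg hs0.le]
      calc _ ≤ K * ρ⁻¹ ^ n * s ^ n := by gcongr; exact hpos n
        _ = K * (s / ρ) ^ n := by rw [div_pow, inv_pow]; ring
    · refine Summable.of_norm_bounded (g := fun n : ℕ => K * (ρ⁻¹) ^ n)
        ((summable_geometric_of_lt_one (by positivity)
          (inv_lt_one_of_one_lt₀ hρ)).mul_left K) fun n => ?_
      rw [hcoeff, norm_mul, zpow_neg, zpow_natCast, norm_inv, norm_pow, Complex.norm_real,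
        Real.norm_of_nonneg hs0.le, laurentCoeff_one_neg]
      refine (mul_le_of_le_one_right (norm_nonneg _) ?_).trans (hpos n)
      exact inv_le_one_of_one_le₀ (one_le_pow₀ hw1)
  have hpt := has_pointwise_sum_fourier_series_of_summable hsum
    ((Complex.arg w : ℝ) : AddCircle (2 * Real.pi))
  have hwexp : (s : ℂ) * Complex.exp (Complex.arg w * Complex.I) = w :=
    Complex.norm_mul_exp_arg_mul_I w
  have hval : g ((Complex.arg w : ℝ) : AddCircle (2 * Real.pi)) = f (joukowski w) := by
    simp only [g, ContinuousMap.coe_mk, htoC, hwexp]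
  rw [hval] at hpt
  refine hpt.congr_fun fun n => ?_
  rw [hcoeff, hfour, smul_eq_mul, mul_assoc (n : ℂ), Complex.exp_int_mul, mul_assoc, ← mul_zpow,
    hwexp]

/-- The **Chebyshev expansion** of a function analytic on a Bernstein ellipse; pairing the Laurent
terms of index `n` and `-n` gives twice the Chebyshev polynomial of degree `n`. -/
lemma exists_hasSum_chebyshev (hρ : 1 < ρ) (hf : AnalyticOnEllipse ρ f) {K : ℝ}
    (hK : ∀ z ∈ bernsteinBoundary ρ, ‖f z‖ ≤ K) :
    ∃ a : ℕ → ℂ, (∀ n, ‖a n‖ ≤ 2 * K * ρ⁻¹ ^ n) ∧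
      ∀ w : ℂ, 1 ≤ ‖w‖ → ‖w‖ < ρ →
        HasSum (fun n : ℕ => a n * (Chebyshev.T ℂ n).eval (joukowski w)) (f (joukowski w)) := by
  have hbd := norm_laurentCoeff_one_le hρ hf hK
  refine ⟨fun n => 2 * laurentCoeff f 1 n - if n = 0 then laurentCoeff f 1 0 else 0,
    fun n => ?_, fun w hw1 hwρ => ?_⟩
  · have := hbd n
    rcases eq_or_ne n 0 with rfl | hn
    · simp only [Nat.cast_zero, if_true, two_mul, add_sub_cancel_right] at this ⊢
      linarith [norm_nonneg (laurentCoeff f 1 0)]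
    · simp only [hn, if_false, sub_zero, norm_mul, Complex.norm_ofNat]
      linarith
  · have hw0 : w ≠ 0 := norm_pos_iff.1 (by linarith)
    have h1 := (hasSum_laurentCoeff hρ hf hK hw1 hwρ).nat_add_neg
    have h2 := hasSum_ite_eq (0 : ℕ) (laurentCoeff f 1 0)
    convert! h1.sub h2 using 1
    · ext n
      rw [eval_T_joukowski n hw0, laurentCoeff_one_neg, zpow_neg, zpow_natCast]
      rcases eq_or_ne n 0 with rfl | hn
      · simp
        ring
      · simp only [hn, if_false]
        ring
    · simp

end Coefficients

/-! ### Least-squares fits at equispaced points -/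

lemma equiPoint_mem_Icc {M : ℕ} (hM : 2 ≤ M) (k : Fin M) : equiPoint M k ∈ Set.Icc (-1 : ℝ) 1 := by
  have hM' : (0 : ℝ) < (M : ℝ) - 1 := by
    have : (2 : ℝ) ≤ M := by exact_mod_cast hM
    linarith
  have hk : (k : ℝ) ≤ (M : ℝ) - 1 := by
    have : ((k : ℕ) : ℝ) + 1 ≤ M := by exact_mod_cast k.2
    linarith
  have h1 : (k : ℝ) * (2 / ((M : ℝ) - 1)) ≤ 2 := by
    rw [mul_div_assoc', div_le_iff₀ hM']; linarith
  have h2 : 0 ≤ (k : ℝ) * (2 / ((M : ℝ) - 1)) := by positivity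
  simp only [equiPoint, Set.mem_Icc]
  constructor <;> linarith

lemma equiPoint_injective {M : ℕ} (hM : 2 ≤ M) : Function.Injective (equiPoint M) := by
  intro k l h
  have hM' : (M : ℝ) - 1 ≠ 0 := by
    have : (2 : ℝ) ≤ M := by exact_mod_cast hM
    linarith
  have h2 := mul_right_cancel₀ (div_ne_zero two_ne_zero hM') (add_left_cancel h)
  exact Fin.ext (by exact_mod_cast h2)

/-- A linear functional that vanishes on the Chebyshev polynomials of degree at most `N` vanishes on
all polynomials of degree at most `N`. -/
lemma eq_zero_of_chebyshev_eq_zero (ℓ : ℂ[X] →ₗ[ℂ] ℂ) (N : ℕ)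
    (h : ∀ j ≤ N, ℓ (Chebyshev.T ℂ j) = 0) (v : ℂ[X]) (hv : v.natDegree ≤ N) : ℓ v = 0 := by
  induction N generalizing v with
  | zero =>
    have h0 := h 0 le_rfl
    rw [Nat.cast_zero, Chebyshev.T_zero] at h0
    rw [eq_C_of_natDegree_le_zero hv, ← mul_one (C _), ← smul_eq_C_mul, map_smul, h0, smul_zero]
  | succ N ih =>
    set T := Chebyshev.T ℂ ((N + 1 : ℕ) : ℤ) with hT
    have hTdeg : T.natDegree = N + 1 := by rw [hT, Chebyshev.natDegree_T, Int.natAbs_natCast]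
    have hTlc : T.coeff (N + 1) ≠ 0 := by
      rw [← hTdeg, coeff_natDegree]
      exact leadingCoeff_ne_zero.2 (Chebyshev.T_ne_zero ℂ _)
    set a := v.coeff (N + 1) / T.coeff (N + 1) with ha
    have hlow : (v - a • T).natDegree ≤ N := by
      rw [natDegree_le_iff_coeff_eq_zero]
      intro m hm
      rw [coeff_sub, coeff_smul, smul_eq_mul]
      rcases (Nat.succ_le_of_lt hm).eq_or_lt with e | e
      · rw [← e, ha, div_mul_cancel₀ _ hTlc, sub_self]
      · rw [coeff_eq_zero_of_natDegree_lt (hv.trans_lt e),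
          coeff_eq_zero_of_natDegree_lt (hTdeg.trans_lt e), mul_zero, sub_zero]
    have := ih (fun j hj => h j (by omega)) _ hlow
    rwa [map_sub, map_smul, h (N + 1) le_rfl, smul_zero, sub_zero] at this

/-- The singular value bound `sum_sq_le_sum_eval_sq` for complex coefficients. -/
lemma sum_norm_sq_le_sum_norm_eval_sq {M R : ℕ} (hM : 2 ≤ M)
    (hR : (R : ℝ) ≤ 1 / 2 * √((M : ℝ) - 1)) (c : Fin (R + 1) → ℂ) :
    2 * ((M : ℝ) - 1) / (125 * (2 * R + 1)) * ∑ j, ‖c j‖ ^ 2 ≤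
      ∑ k : Fin M, ‖(chebSum c).eval (equiPoint M k : ℂ)‖ ^ 2 := by
  have hre := sum_sq_le_sum_eval_sq hM hR fun j => (c j).re
  have him := sum_sq_le_sum_eval_sq hM hR fun j => (c j).im
  have h1 : ∑ j, ‖c j‖ ^ 2 = ∑ j, (c j).re ^ 2 + ∑ j, (c j).im ^ 2 := by
    rw [← Finset.sum_add_distrib]
    exact Finset.sum_congr rfl fun j _ => by rw [Complex.sq_norm, Complex.normSq_apply]; ring
  have h2 : ∀ k : Fin M, ‖(chebSum c).eval (equiPoint M k : ℂ)‖ ^ 2 =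
      (chebSum fun j => (c j).re).eval (equiPoint M k) ^ 2 +
        (chebSum fun j => (c j).im).eval (equiPoint M k) ^ 2 := by
    intro k
    rw [Complex.sq_norm, Complex.normSq_apply]
    simp only [eval_chebSum, ← Chebyshev.complex_ofReal_eval_T, Complex.re_sum, Complex.im_sum,
      Complex.re_mul_ofReal, Complex.im_mul_ofReal]
    ring
  rw [h1, mul_add]
  simp only [h2, Finset.sum_add_distrib]
  exact add_le_add hre him

lemma transpose_chebMatrix_mulVec {M R : ℕ} (c : Fin (R + 1) → ℝ) (k : Fin M) :
    ((chebMatrix M R).transpose.mulVec c) k = (chebSum c).eval (equiPoint M k) := by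
  simp only [eval_chebSum, Matrix.mulVec, dotProduct, Matrix.transpose_apply, chebMatrix,
    Matrix.of_apply, mul_comm]

lemma isUnit_det_gram {M R : ℕ} (hM : 2 ≤ M) (hR : (R : ℝ) ≤ 1 / 2 * √((M : ℝ) - 1)) :
    IsUnit (chebMatrix M R * (chebMatrix M R).transpose).det := by
  rw [← Matrix.isUnit_iff_isUnit_det, ← Matrix.mulVec_injective_iff_isUnit,
    ← Matrix.coe_mulVecLin, ← LinearMap.ker_eq_bot, LinearMap.ker_eq_bot']
  intro c hc
  rw [Matrix.mulVecLin_apply] at hc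
  have h0 : ∑ k : Fin M, (chebSum c).eval (equiPoint M k) ^ 2 = 0 := by
    have : c ⬝ᵥ ((chebMatrix M R * (chebMatrix M R).transpose).mulVec c) = 0 := by
      rw [hc, dotProduct_zero]
    rw [← Matrix.mulVec_mulVec, Matrix.dotProduct_mulVec, ← Matrix.mulVec_transpose] at this
    simpa only [dotProduct, transpose_chebMatrix_mulVec, ← sq] using this
  have h1 := sum_sq_le_sum_eval_sq hM hR c
  have hM' : (0 : ℝ) < (M : ℝ) - 1 := by
    have : (2 : ℝ) ≤ M := by exact_mod_cast hM
    linarith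
  rw [h0] at h1
  have h2 : ∑ j, c j ^ 2 ≤ 0 := nonpos_of_mul_nonpos_right h1 (by positivity)
  have h3 := (Finset.sum_eq_zero_iff_of_nonneg fun j _ => sq_nonneg (c j)).1
    (h2.antisymm (Finset.sum_nonneg fun j _ => sq_nonneg (c j)))
  ext j
  simpa using h3 j (Finset.mem_univ j)

lemma rowPinv_mul_gram {M R : ℕ} (hM : 2 ≤ M) (hR : (R : ℝ) ≤ 1 / 2 * √((M : ℝ) - 1)) :
    rowPinv (chebMatrix M R) * chebMatrix M R * (chebMatrix M R).transpose =
      (chebMatrix M R).transpose := by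
  rw [rowPinv, Matrix.mul_assoc, Matrix.mul_assoc,
    Matrix.nonsing_inv_mul _ (isUnit_det_gram hM hR), Matrix.mul_one]

/-- The fit `y Q† (q_0, …, q_R)ᵀ` of scalar samples `y`; it is one entry of `chebFit`. -/
def scalarFit (M R : ℕ) (y : Fin M → ℂ) : ℂ[X] :=
  chebSum fun j => ∑ k, y k * (rowPinv (chebMatrix M R) k j : ℂ)

lemma chebFit_apply {n : ℕ} (M R : ℕ) (x : ℂ → EuclideanSpace ℂ (Fin n)) (i : Fin n) :
    chebFit M R x i = scalarFit M R fun k => x (equiPoint M k : ℂ) i := by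
  simp [chebFit, scalarFit, chebSum, fitCoeff, historyMatrix, Matrix.mul_apply]

lemma eval_scalarFit {M R : ℕ} (y : Fin M → ℂ) (k : Fin M) :
    (scalarFit M R y).eval (equiPoint M k : ℂ) =
      ∑ l, y l * ((rowPinv (chebMatrix M R) * chebMatrix M R) l k : ℝ) := by
  simp only [scalarFit, eval_chebSum, Finset.sum_mul, Matrix.mul_apply, Complex.ofReal_sum,
    Finset.mul_sum, Complex.ofReal_mul, ← Chebyshev.complex_ofReal_eval_T]
  rw [Finset.sum_comm]
  exact Finset.sum_congr rfl fun l _ => Finset.sum_congr rfl fun j _ => mul_assoc _ _ _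

/-- The normal equations: the residual of the fit is orthogonal to all polynomials of degree at most
`R`. -/
lemma sum_residual_mul_eval {M R : ℕ} (hM : 2 ≤ M) (hR : (R : ℝ) ≤ 1 / 2 * √((M : ℝ) - 1))
    (y : Fin M → ℂ) (v : ℂ[X]) (hv : v.natDegree ≤ R) :
    ∑ k, (y k - (scalarFit M R y).eval (equiPoint M k : ℂ)) * v.eval (equiPoint M k : ℂ) = 0 := by
  let ℓ : ℂ[X] →ₗ[ℂ] ℂ := ∑ k,
    (y k - (scalarFit M R y).eval (equiPoint M k : ℂ)) • leval (equiPoint M k : ℂ)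
  have hℓ : ∀ v, ℓ v =
      ∑ k, (y k - (scalarFit M R y).eval (equiPoint M k : ℂ)) * v.eval (equiPoint M k : ℂ) := by
    intro v
    simp [ℓ, leval]
  rw [← hℓ]
  refine eq_zero_of_chebyshev_eq_zero ℓ R (fun j hj => ?_) v hv
  rw [hℓ]
  have hentry : ∀ l, ∑ k, ((rowPinv (chebMatrix M R) * chebMatrix M R) l k : ℂ) *
      (Chebyshev.T ℂ j).eval (equiPoint M k : ℂ) = (Chebyshev.T ℂ j).eval (equiPoint M l : ℂ) := by
    intro l
    have := congrFun (congrFun (rowPinv_mul_gram hM hR) l) ⟨j, by omega⟩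
    rw [Matrix.mul_apply] at this
    simp only [← Chebyshev.complex_ofReal_eval_T]
    exact_mod_cast this
  simp only [sub_mul, Finset.sum_sub_distrib, eval_scalarFit, Finset.sum_mul]
  rw [Finset.sum_comm (f := fun k l => _), sub_eq_zero]
  refine Finset.sum_congr rfl fun l _ => ?_
  rw [← hentry l, Finset.mul_sum]
  exact Finset.sum_congr rfl fun k _ => (mul_assoc _ _ _).symm

/-- Pythagoras' theorem for the fit, which is an orthogonal projection of the samples. -/
lemma sum_norm_sub_eval_sq {M R : ℕ} (hM : 2 ≤ M) (hR : (R : ℝ) ≤ 1 / 2 * √((M : ℝ) - 1))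
    (y : Fin M → ℂ) (v : ℂ[X]) (hv : v.natDegree ≤ R) :
    ∑ k, ‖y k - v.eval (equiPoint M k : ℂ)‖ ^ 2 =
      ∑ k, ‖y k - (scalarFit M R y).eval (equiPoint M k : ℂ)‖ ^ 2 +
        ∑ k, ‖(scalarFit M R y - v).eval (equiPoint M k : ℂ)‖ ^ 2 := by
  set u := scalarFit M R y - v with hu
  have hudeg : u.natDegree ≤ R :=
    (natDegree_sub_le _ _).trans (max_le (natDegree_chebSum_le _) hv)
  -- the nodes are real, so that the conjugate of `u` at a node is the value of a polynomial
  have horth := sum_residual_mul_eval hM hR y (u.map (starRingEnd ℂ))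
    (natDegree_map_le.trans hudeg)
  have hconj : ∀ k, (u.map (starRingEnd ℂ)).eval (equiPoint M k : ℂ) =
      starRingEnd ℂ (u.eval (equiPoint M k : ℂ)) := by
    intro k
    rw [eval_map, ← eval₂_at_apply, Complex.conj_ofReal]
  simp only [hconj] at horth
  have hre := congrArg Complex.re horth
  rw [Complex.re_sum, Complex.zero_re] at hre
  have hpt : ∀ k, ‖y k - v.eval (equiPoint M k : ℂ)‖ ^ 2 =
      ‖y k - (scalarFit M R y).eval (equiPoint M k : ℂ)‖ ^ 2 + ‖u.eval (equiPoint M k : ℂ)‖ ^ 2 +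
        2 * ((y k - (scalarFit M R y).eval (equiPoint M k : ℂ)) *
          starRingEnd ℂ (u.eval (equiPoint M k : ℂ))).re := by
    intro k
    rw [show y k - v.eval (equiPoint M k : ℂ) =
      (y k - (scalarFit M R y).eval (equiPoint M k : ℂ)) + u.eval (equiPoint M k : ℂ) by
        rw [hu, eval_sub]; ring]
    simp only [Complex.sq_norm]
    exact Complex.normSq_add _ _
  simp only [hpt, Finset.sum_add_distrib, ← Finset.mul_sum, hre]
  ring

lemma lt_of_le_half_sqrt {M R : ℕ} (hM : 2 ≤ M) (hR : (R : ℝ) ≤ 1 / 2 * √((M : ℝ) - 1)) :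
    R < M := by
  have hM' : (2 : ℝ) ≤ M := by exact_mod_cast hM
  have : √((M : ℝ) - 1) ≤ M - 1 := Real.sqrt_le_iff.2 ⟨by linarith, by nlinarith⟩
  have : (R : ℝ) < M := by linarith
  exact_mod_cast this

lemma eq_zero_of_sum_norm_eval_sq {M R : ℕ} (hM : 2 ≤ M)
    (hR : (R : ℝ) ≤ 1 / 2 * √((M : ℝ) - 1)) {u : ℂ[X]} (hu : u.natDegree ≤ R)
    (h : ∑ k : Fin M, ‖u.eval (equiPoint M k : ℂ)‖ ^ 2 = 0) : u = 0 := by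
  refine eq_zero_of_natDegree_lt_card_of_eval_eq_zero u
    (f := fun k : Fin M => (equiPoint M k : ℂ))
    (Complex.ofReal_injective.comp (equiPoint_injective hM)) (fun k => ?_)
    (by rw [Fintype.card_fin]; exact hu.trans_lt (lt_of_le_half_sqrt hM hR))
  have := (Finset.sum_eq_zero_iff_of_nonneg fun k _ => sq_nonneg _).1 h k (Finset.mem_univ k)
  simpa using this

/-- Pythagoras' theorem for vector-valued polynomials. -/
lemma sum_norm_sub_evalVec_sq {n M R : ℕ} (hM : 2 ≤ M) (hR : (R : ℝ) ≤ 1 / 2 * √((M : ℝ) - 1))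
    (x : ℂ → EuclideanSpace ℂ (Fin n)) (v : Fin n → ℂ[X]) (hv : ∀ i, (v i).natDegree ≤ R) :
    ∑ k : Fin M, ‖x (equiPoint M k : ℂ) - evalVec v (equiPoint M k : ℂ)‖ ^ 2 =
      ∑ k : Fin M, ‖x (equiPoint M k : ℂ) - evalVec (chebFit M R x) (equiPoint M k : ℂ)‖ ^ 2 +
        ∑ i, ∑ k : Fin M, ‖(chebFit M R x i - v i).eval (equiPoint M k : ℂ)‖ ^ 2 := by
  have hsplit : ∀ q : Fin n → ℂ[X],
      ∑ k : Fin M, ‖x (equiPoint M k : ℂ) - evalVec q (equiPoint M k : ℂ)‖ ^ 2 =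
        ∑ i, ∑ k : Fin M, ‖x (equiPoint M k : ℂ) i - (q i).eval (equiPoint M k : ℂ)‖ ^ 2 := by
    intro q
    rw [Finset.sum_comm]
    refine Finset.sum_congr rfl fun k _ => ?_
    rw [EuclideanSpace.norm_sq_eq]
    rfl
  rw [hsplit, hsplit, ← Finset.sum_add_distrib]
  refine Finset.sum_congr rfl fun i _ => ?_
  rw [chebFit_apply]
  exact sum_norm_sub_eval_sq hM hR _ (v i) (hv i)

lemma natDegree_chebFit_le {n : ℕ} (M R : ℕ) (x : ℂ → EuclideanSpace ℂ (Fin n)) (i : Fin n) :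
    (chebFit M R x i).natDegree ≤ R := natDegree_chebSum_le _

lemma isLeastSquaresFit_chebFit {n M R : ℕ} (hM : 2 ≤ M)
    (hR : (R : ℝ) ≤ 1 / 2 * √((M : ℝ) - 1)) (x : ℂ → EuclideanSpace ℂ (Fin n)) :
    IsLeastSquaresFit M R x (chebFit M R x) := by
  refine ⟨natDegree_chebFit_le M R x, fun v hv => ?_⟩
  rw [sum_norm_sub_evalVec_sq hM hR x v hv]
  exact le_add_of_nonneg_right
    (Finset.sum_nonneg fun i _ => Finset.sum_nonneg fun k _ => sq_nonneg _)

lemma IsLeastSquaresFit.eq_chebFit {n M R : ℕ} (hM : 2 ≤ M)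
    (hR : (R : ℝ) ≤ 1 / 2 * √((M : ℝ) - 1)) {x : ℂ → EuclideanSpace ℂ (Fin n)}
    {v : Fin n → ℂ[X]} (hv : IsLeastSquaresFit M R x v) : v = chebFit M R x := by
  have h1 := hv.2 _ (natDegree_chebFit_le M R x)
  rw [sum_norm_sub_evalVec_sq hM hR x v hv.1] at h1
  have hnn : ∀ i, 0 ≤ ∑ k : Fin M, ‖(chebFit M R x i - v i).eval (equiPoint M k : ℂ)‖ ^ 2 :=
    fun i => Finset.sum_nonneg fun k _ => sq_nonneg _
  have h2 := (Finset.sum_eq_zero_iff_of_nonneg fun i _ => hnn i).1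
    ((add_le_iff_nonpos_right _).1 h1 |>.antisymm (Finset.sum_nonneg fun i _ => hnn i))
  funext i
  exact (sub_eq_zero.1 (eq_zero_of_sum_norm_eval_sq hM hR
    ((natDegree_sub_le _ _).trans (max_le (natDegree_chebFit_le M R x i) (hv.1 i)))
    (h2 i (Finset.mem_univ i)))).symm

/-! ### The error of the scalar fit -/

/-- The truncation error of a Chebyshev series with geometrically decaying coefficients. -/
lemma norm_sub_eval_chebSum_le {a : ℕ → ℂ} {K ρ : ℝ} (hρ : 0 < ρ)
    (ha : ∀ n, ‖a n‖ ≤ 2 * K * ρ⁻¹ ^ n) {w F : ℂ} (hw1 : 1 ≤ ‖w‖) (hwρ : ‖w‖ < ρ)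
    (hF : HasSum (fun n : ℕ => a n * (Chebyshev.T ℂ n).eval (joukowski w)) F) (R : ℕ) :
    ‖F - (chebSum fun j : Fin (R + 1) => a j).eval (joukowski w)‖ ≤
      2 * K * (1 / (1 - ‖w‖ / ρ)) * (‖w‖ / ρ) ^ (R + 1) := by
  have htail := (hasSum_nat_add_iff' (R + 1)).2 hF
  rw [← Fin.sum_univ_eq_sum_range
    (fun n : ℕ => a n * (Chebyshev.T ℂ n).eval (joukowski w)), ← eval_chebSum
    (fun j : Fin (R + 1) => a j)] at htail
  have hgeom := (hasSum_geometric_of_lt_one (div_nonneg (norm_nonneg w) hρ.le)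
    ((div_lt_one hρ).2 hwρ)).mul_left (2 * K * (‖w‖ / ρ) ^ (R + 1))
  refine (htail.norm_le_of_bounded hgeom fun n => ?_).trans_eq (by rw [one_div]; ring)
  have hT : ‖(Chebyshev.T ℂ ((n + (R + 1) : ℕ) : ℤ)).eval (joukowski w)‖ ≤
      ‖w‖ ^ (n + (R + 1)) := norm_eval_T_joukowski_le _ hw1
  rw [norm_mul]
  calc _ ≤ 2 * K * ρ⁻¹ ^ (n + (R + 1)) * ‖w‖ ^ (n + (R + 1)) :=
        mul_le_mul (ha _) hT (norm_nonneg _) ((norm_nonneg _).trans (ha _))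
    _ = 2 * K * (‖w‖ / ρ) ^ (R + 1) * (‖w‖ / ρ) ^ n := by
        rw [div_pow, div_pow, inv_pow, pow_add _ n]; field_simp; ring

lemma exists_joukowski_eq_ofReal {t : ℝ} (ht : t ∈ Set.Icc (-1 : ℝ) 1) :
    ∃ w : ℂ, ‖w‖ = 1 ∧ joukowski w = t := by
  refine ⟨Complex.exp (Real.arccos t * Complex.I), Complex.norm_exp_ofReal_mul_I _, ?_⟩
  rw [joukowski, ← Complex.exp_neg, ← neg_mul]
  change Complex.cos (Real.arccos t) = t
  rw [← Complex.ofReal_cos, Real.cos_arccos ht.1 ht.2]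

/-- Outside `[-1, 1]` a polynomial is at most as large as its Chebyshev coefficients allow, by the
Cauchy-Schwarz inequality and `T_j(t) ≤ w^j` for `t = (w + w⁻¹) / 2`. -/
lemma norm_eval_chebSum_sq_le {R : ℕ} (c : Fin (R + 1) → ℂ) {w : ℝ} (hw : 1 < w) :
    ‖(chebSum c).eval (joukowski w)‖ ^ 2 ≤
      (∑ j, ‖c j‖ ^ 2) * ((w ^ (R + 1)) ^ 2 / (w ^ 2 - 1)) := by
  have hw0 : 0 < w := by linarith
  have hT : ∀ j : ℕ, ‖(Chebyshev.T ℂ j).eval (joukowski w)‖ ≤ w ^ j := by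
    intro j
    have hnorm : ‖(w : ℂ)‖ = w := by rw [Complex.norm_real, Real.norm_of_nonneg hw0.le]
    have := norm_eval_T_joukowski_le j (hw.le.trans_eq hnorm.symm)
    rwa [hnorm] at this
  have hgeom : ∑ j : Fin (R + 1), (w ^ (j : ℕ)) ^ 2 ≤ (w ^ (R + 1)) ^ 2 / (w ^ 2 - 1) := by
    have hw2 : 1 < w ^ 2 := one_lt_pow₀ hw two_ne_zero
    rw [Fin.sum_univ_eq_sum_range (fun j => (w ^ j) ^ 2)]
    simp only [pow_right_comm w _ 2]
    rw [geom_sum_eq hw2.ne']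
    have := sub_pos.2 hw2
    gcongr
    linarith
  calc ‖(chebSum c).eval (joukowski w)‖ ^ 2 ≤ (∑ j, ‖c j‖ * w ^ (j : ℕ)) ^ 2 := by
        rw [eval_chebSum]
        gcongr
        refine norm_sum_le_of_le _ fun j _ => ?_
        rw [norm_mul]
        gcongr
        exact hT j
    _ ≤ (∑ j, ‖c j‖ ^ 2) * ∑ j : Fin (R + 1), (w ^ (j : ℕ)) ^ 2 :=
        Finset.sum_mul_sq_le_sq_mul_sq _ _ _
    _ ≤ _ := by gcongr

lemma chebSum_sub {F : Type*} [Field F] {R : ℕ} (c d : Fin (R + 1) → F) :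
    chebSum c - chebSum d = chebSum fun j => c j - d j := by
  simp [chebSum, sub_mul, Finset.sum_sub_distrib]

lemma extrapConst_sq {M R : ℕ} (hM : 2 ≤ M) :
    extrapConst M R ^ 2 * (2 * ((M : ℝ) - 1) / (125 * (2 * R + 1))) = M := by
  have hM' : (0 : ℝ) < (M : ℝ) - 1 := by
    have : (2 : ℝ) ≤ M := by exact_mod_cast hM
    linarith
  rw [extrapConst, div_pow, mul_pow, mul_pow, mul_pow, Real.sq_sqrt (by positivity),
    Real.sq_sqrt (by positivity), Real.sq_sqrt (by positivity), Real.sq_sqrt (by positivity)]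
  field_simp
  norm_num

/-- A fit whose samples differ by at most `G` from those of a polynomial `q` of degree at most `R`
differs little from `q` outside `[-1, 1]`: projecting does not increase the norm of the samples, the
samples control the Chebyshev coefficients, and these control the values. -/
lemma norm_eval_scalarFit_sub_le {M R : ℕ} (hM : 2 ≤ M) (hR : (R : ℝ) ≤ 1 / 2 * √((M : ℝ) - 1))
    (y : Fin M → ℂ) (c : Fin (R + 1) → ℂ) {G : ℝ} (hG : 0 ≤ G)
    (hy : ∀ k, ‖y k - (chebSum c).eval (equiPoint M k : ℂ)‖ ≤ G) {w : ℝ} (hw : 1 < w) :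
    ‖(scalarFit M R y - chebSum c).eval (joukowski w)‖ ≤
      extrapConst M R * G * (w ^ (R + 1) / √(w ^ 2 - 1)) := by
  have hw0 : 0 < w := by linarith
  have hM' : (0 : ℝ) < (M : ℝ) - 1 := by
    have : (2 : ℝ) ≤ M := by exact_mod_cast hM
    linarith
  have hw2 : 0 < w ^ 2 - 1 := sub_pos.2 (one_lt_pow₀ hw two_ne_zero)
  have hC0 : 0 ≤ extrapConst M R := by unfold extrapConst; positivity
  have hpyth := sum_norm_sub_eval_sq hM hR y (chebSum c) (natDegree_chebSum_le c)
  rw [scalarFit, chebSum_sub] at hpyth ⊢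
  set d : Fin (R + 1) → ℂ := _
  have hsamples : ∑ k : Fin M, ‖(chebSum d).eval (equiPoint M k : ℂ)‖ ^ 2 ≤ M * G ^ 2 := by
    calc _ ≤ ∑ k, ‖y k - (chebSum c).eval (equiPoint M k : ℂ)‖ ^ 2 := by
          rw [hpyth]
          exact le_add_of_nonneg_left (Finset.sum_nonneg fun k _ => sq_nonneg _)
      _ ≤ ∑ _k : Fin M, G ^ 2 := by gcongr with k; exact hy k
      _ = M * G ^ 2 := by simp
  have hcoeff : ∑ j, ‖d j‖ ^ 2 ≤ extrapConst M R ^ 2 * G ^ 2 := by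
    have h1 := (sum_norm_sq_le_sum_norm_eval_sq hM hR d).trans hsamples
    have hC := extrapConst_sq (R := R) hM
    set σ : ℝ := 2 * ((M : ℝ) - 1) / (125 * (2 * R + 1))
    have hσ0 : 0 < σ := by positivity
    refine le_of_mul_le_mul_left (h1.trans_eq ?_) hσ0
    rw [← hC]
    ring
  refine le_of_sq_le_sq ?_ (by positivity)
  refine (norm_eval_chebSum_sq_le d hw).trans ?_
  rw [mul_pow, mul_pow, div_pow, Real.sq_sqrt hw2.le]
  gcongr

lemma joukowski_add_sqrt {t : ℝ} (ht : 1 < t) : joukowski ((t + √(t ^ 2 - 1) : ℝ) : ℂ) = t := by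
  have h : 0 ≤ t ^ 2 - 1 := by nlinarith
  have hpos : 0 < t + √(t ^ 2 - 1) := by positivity
  have : ((t + √(t ^ 2 - 1)) + (t + √(t ^ 2 - 1))⁻¹) / 2 = t := by
    have hs := Real.sq_sqrt h
    rw [div_eq_iff two_ne_zero, ← sub_eq_zero]
    field_simp
    nlinarith
  rw [joukowski]
  exact_mod_cast this

lemma add_sqrt_lt {ρ t : ℝ} (hρ : 1 < ρ) (ht : 1 < t) (htρ : t < (ρ + ρ⁻¹) / 2) :
    t + √(t ^ 2 - 1) < ρ := by
  have h : 0 ≤ t ^ 2 - 1 := by nlinarith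
  have hJ := joukowski_add_sqrt ht
  set w := t + √(t ^ 2 - 1) with hw
  have hw1 : 1 < w := by linarith [Real.sqrt_nonneg (t ^ 2 - 1)]
  have hJ' : (w + w⁻¹) / 2 = t := by
    rw [joukowski] at hJ; exact_mod_cast hJ
  by_contra! hle
  rcases hle.eq_or_lt with e | e
  · rw [← e] at hJ'; linarith
  · linarith [add_inv_lt_add_inv hρ.le e]

/-- The error bound for scalar functions: `f - p` is the tail of the Chebyshev series of `f` beyond
degree `R`, minus the fit of the samples of this tail. -/
lemma norm_sub_eval_scalarFit_le {M R : ℕ} (hM : 2 ≤ M)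
    (hR : (R : ℝ) ≤ 1 / 2 * √((M : ℝ) - 1)) {ρ : ℝ} (hρ : 1 < ρ) {f : ℂ → ℂ}
    (hf : AnalyticOnEllipse ρ f) {K : ℝ} (hK : ∀ z ∈ bernsteinBoundary ρ, ‖f z‖ ≤ K)
    {t : ℝ} (ht : 1 < t) (htρ : t < (ρ + ρ⁻¹) / 2) :
    ‖f t - (scalarFit M R fun k => f (equiPoint M k)).eval (t : ℂ)‖ ≤
      2 * K * (1 / (1 - rate ρ t) +
        extrapConst M R * ρ / ((ρ - 1) * √(ρ ^ 2 * rate ρ t ^ 2 - 1))) *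
          rate ρ t ^ (R + 1) := by
  have hρ0 : 0 < ρ := by linarith
  have hρ1 : ρ - 1 ≠ 0 := by linarith
  have hwρ := add_sqrt_lt hρ ht htρ
  have hJ := joukowski_add_sqrt ht
  have hrate : rate ρ t = (t + √(t ^ 2 - 1)) / ρ := rfl
  have hw1 : 1 < t + √(t ^ 2 - 1) := by linarith [Real.sqrt_nonneg (t ^ 2 - 1)]
  set w := t + √(t ^ 2 - 1)
  have hwn : ‖(w : ℂ)‖ = w := by rw [Complex.norm_real, Real.norm_of_nonneg (by linarith)]
  have hρr : ρ ^ 2 * rate ρ t ^ 2 = w ^ 2 := by rw [hrate]; field_simp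
  have hK0 : 0 ≤ K := by
    refine (norm_nonneg _).trans (hK (joukowski ρ) ?_)
    have := joukowski_mem_bernsteinBoundary (w := (ρ : ℂ)) (by exact_mod_cast hρ0.ne')
    rwa [Complex.norm_real, Real.norm_of_nonneg hρ0.le] at this
  obtain ⟨a, ha, hsum⟩ := exists_hasSum_chebyshev hρ hf hK
  set c : Fin (R + 1) → ℂ := fun j => a j
  have htail := norm_sub_eval_chebSum_le hρ0 ha (by rw [hwn]; exact hw1.le)
    (by rw [hwn]; exact hwρ) (hsum w (by rw [hwn]; exact hw1.le) (by rw [hwn]; exact hwρ)) R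
  rw [hwn, hJ, ← hrate] at htail
  set G : ℝ := 2 * K * (1 / (1 - 1 / ρ)) * (1 / ρ) ^ (R + 1) with hGdef
  have hG : 0 ≤ G := by
    have : 0 < 1 - 1 / ρ := sub_pos.2 ((div_lt_one hρ0).2 hρ)
    positivity
  have hnodes : ∀ k, ‖f (equiPoint M k) - (chebSum c).eval (equiPoint M k : ℂ)‖ ≤ G := by
    intro k
    obtain ⟨u, hu, huJ⟩ := exists_joukowski_eq_ofReal (equiPoint_mem_Icc hM k)
    have := norm_sub_eval_chebSum_le hρ0 ha hu.ge (hu.trans_lt hρ)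
      (hsum u hu.ge (hu.trans_lt hρ)) R
    rwa [hu, huJ] at this
  have hfit := norm_eval_scalarFit_sub_le hM hR _ c hG hnodes hw1
  rw [hJ, eval_sub] at hfit
  have hG' : G * w ^ (R + 1) = 2 * K * (ρ / (ρ - 1)) * rate ρ t ^ (R + 1) := by
    rw [hGdef, hrate, one_div_pow, div_pow]
    field_simp
  calc _ = ‖(f t - (chebSum c).eval (t : ℂ)) - ((scalarFit M R fun k =>
          f (equiPoint M k)).eval (t : ℂ) - (chebSum c).eval (t : ℂ))‖ := by
        rw [sub_sub_sub_cancel_right]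
    _ ≤ 2 * K * (1 / (1 - rate ρ t)) * rate ρ t ^ (R + 1) +
        extrapConst M R * G * (w ^ (R + 1) / √(w ^ 2 - 1)) :=
        (norm_sub_le _ _).trans (add_le_add htail hfit)
    _ = 2 * K * (1 / (1 - rate ρ t)) * rate ρ t ^ (R + 1) +
        extrapConst M R * (G * w ^ (R + 1)) / √(w ^ 2 - 1) := by ring
    _ = _ := by
        rw [hG', hρr, mul_comm (ρ - 1), ← div_div]
        ring

/-! ### The solution of the linear system -/

section Solution

variable {n : ℕ} {ρ : ℝ} {A : ℂ → Matrix (Fin n) (Fin n) ℂ} {b : ℂ → Fin n → ℂ}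

lemma bernsteinEllipse_subset_closed (ρ : ℝ) : bernsteinEllipse ρ ⊆ closedBernsteinEllipse ρ :=
  fun z hz => show ‖z - 1‖ + ‖z + 1‖ ≤ ρ + ρ⁻¹ from le_of_lt hz

lemma AnalyticOnEllipse.const_mul {f : ℂ → ℂ} (hf : AnalyticOnEllipse ρ f) (c : ℂ) :
    AnalyticOnEllipse ρ fun z => c * f z :=
  ⟨analyticOnNhd_const.mul hf.1, continuousOn_const.mul hf.2⟩

lemma AnalyticOnEllipse.sum {ι : Type*} {s : Finset ι} {f : ι → ℂ → ℂ}
    (hf : ∀ i ∈ s, AnalyticOnEllipse ρ (f i)) : AnalyticOnEllipse ρ fun z => ∑ i ∈ s, f i z :=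
  ⟨Finset.analyticOnNhd_fun_sum _ fun i hi => (hf i hi).1,
    continuousOn_finsetSum _ fun i hi => (hf i hi).2⟩

lemma AnalyticOnEllipse.det (hA : ∀ i j, AnalyticOnEllipse ρ fun z => A z i j) :
    AnalyticOnEllipse ρ fun z => (A z).det := by
  simp only [Matrix.det_apply']
  exact .sum fun σ _ => .const_mul ⟨Finset.analyticOnNhd_fun_prod _ fun i _ => (hA _ _).1,
    continuousOn_finsetProd _ fun i _ => (hA _ _).2⟩ _

/-- By Cramer's rule. -/
lemma AnalyticOnEllipse.solution (hA : ∀ i j, AnalyticOnEllipse ρ fun z => A z i j)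
    (hb : ∀ i, AnalyticOnEllipse ρ fun z => b z i)
    (hinv : ∀ z ∈ closedBernsteinEllipse ρ, IsUnit (A z)) (i : Fin n) :
    AnalyticOnEllipse ρ fun z => solution A b z i := by
  have hcramer : ∀ z, ChebExtrapolation.solution A b z i =
      ((A z).updateCol i (b z)).det / (A z).det := by
    intro z
    simp only [ChebExtrapolation.solution, Matrix.inv_def, Ring.inverse_eq_inv',
      Matrix.smul_mulVec, ← Matrix.cramer_eq_adjugate_mulVec, Pi.smul_apply, Matrix.cramer_apply,
      smul_eq_mul]
    rw [div_eq_inv_mul]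
  have hdet : ∀ z ∈ closedBernsteinEllipse ρ, (A z).det ≠ 0 := fun z hz =>
    ((Matrix.isUnit_iff_isUnit_det _).1 (hinv z hz)).ne_zero
  have hden := AnalyticOnEllipse.det hA
  have hnum : AnalyticOnEllipse ρ fun z => ((A z).updateCol i (b z)).det := by
    refine AnalyticOnEllipse.det fun k l => ?_
    rcases eq_or_ne l i with rfl | h
    · simpa only [Matrix.updateCol_self] using hb k
    · simpa only [Matrix.updateCol_ne h] using hA k l
  simp only [hcramer]
  exact ⟨hnum.1.div hden.1 fun z hz => hdet z (bernsteinEllipse_subset_closed ρ hz),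
    hnum.2.div hden.2 hdet⟩

end Solution

lemma isCompact_bernsteinBoundary (ρ : ℝ) : IsCompact (bernsteinBoundary ρ) := by
  refine Metric.isCompact_of_isClosed_isBounded
    (isClosed_eq (by fun_prop) continuous_const) ?_
  refine (Metric.isBounded_closedBall (x := (0 : ℂ)) (r := ρ + ρ⁻¹)).subset fun z hz => ?_
  rw [mem_closedBall_zero_iff, ← (show ‖z - 1‖ + ‖z + 1‖ = ρ + ρ⁻¹ from hz)]
  have h : ‖(z - 1) + (z + 1)‖ = 2 * ‖z‖ := by
    rw [show (z - 1) + (z + 1) = 2 * z by ring, norm_mul, Complex.norm_ofNat]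
  linarith [norm_add_le (z - 1) (z + 1), norm_nonneg z]

/-- The supremum that defines `kappa` is that of a bounded set. -/
lemma norm_le_kappa {n : ℕ} {ρ : ℝ} {x : ℂ → EuclideanSpace ℂ (Fin n)}
    (hx : ∀ i, AnalyticOnEllipse ρ fun z => x z i) {z : ℂ} (hz : z ∈ bernsteinBoundary ρ) :
    ‖x z‖ ≤ kappa ρ x := by
  have hcont : ContinuousOn x (bernsteinBoundary ρ) := by
    have h : ContinuousOn (fun z i => x z i) (bernsteinBoundary ρ) :=
      continuousOn_pi.2 fun i => (hx i).2.mono fun z hz => le_of_eq hz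
    exact (PiLp.continuous_toLp 2 (fun _ : Fin n => ℂ)).comp_continuousOn h
  exact le_csSup ((isCompact_bernsteinBoundary ρ).bddAbove_image hcont.norm)
    (Set.mem_image_of_mem _ hz)

lemma inner_evalVec_chebFit {n M R : ℕ} (x : ℂ → EuclideanSpace ℂ (Fin n))
    (e : EuclideanSpace ℂ (Fin n)) (z : ℂ) :
    inner ℂ e (evalVec (chebFit M R x) z) =
      (scalarFit M R fun k => inner ℂ e (x (equiPoint M k))).eval z := by
  have hinner : ∀ v : EuclideanSpace ℂ (Fin n), inner ℂ e v = ∑ i, starRingEnd ℂ (e i) * v i := by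
    intro v
    rw [PiLp.inner_apply]
    exact Finset.sum_congr rfl fun i _ => mul_comm _ _
  simp only [hinner, evalVec, chebFit_apply, scalarFit, eval_chebSum, Finset.sum_mul,
    Finset.mul_sum]
  rw [Finset.sum_comm]
  refine Finset.sum_congr rfl fun j _ => ?_
  rw [Finset.sum_comm]
  exact Finset.sum_congr rfl fun k _ => Finset.sum_congr rfl fun i _ => by ring

/-- The vector-valued bound follows from the scalar one, applied to `z ↦ ⟪e, x(z)⟫` where `e` is the
error at `t`. -/
lemma norm_sub_evalVec_chebFit_le {n M R : ℕ} (hM : 2 ≤ M)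
    (hR : (R : ℝ) ≤ 1 / 2 * √((M : ℝ) - 1)) {ρ : ℝ} (hρ : 1 < ρ)
    {x : ℂ → EuclideanSpace ℂ (Fin n)} (hx : ∀ i, AnalyticOnEllipse ρ fun z => x z i)
    {t : ℝ} (ht : 1 < t) (htρ : t < (ρ + ρ⁻¹) / 2) :
    ‖x (t : ℂ) - evalVec (chebFit M R x) (t : ℂ)‖ ≤
      2 * kappa ρ x * (1 / (1 - rate ρ t) +
        extrapConst M R * ρ / ((ρ - 1) * √(ρ ^ 2 * rate ρ t ^ 2 - 1))) *
          rate ρ t ^ (R + 1) := by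
  set e := x (t : ℂ) - evalVec (chebFit M R x) (t : ℂ) with he
  have hf : AnalyticOnEllipse ρ fun z => inner ℂ e (x z) := by
    simp only [PiLp.inner_apply, RCLike.inner_apply']
    exact .sum fun i _ => (hx i).const_mul _
  have hK : ∀ z ∈ bernsteinBoundary ρ, ‖inner ℂ e (x z)‖ ≤ ‖e‖ * kappa ρ x := fun z hz =>
    (norm_inner_le_norm _ _).trans (by gcongr; exact norm_le_kappa hx hz)
  have hmain := norm_sub_eval_scalarFit_le hM hR hρ hf hK ht htρ
  rw [← inner_evalVec_chebFit, ← inner_sub_right, ← he, inner_self_eq_norm_sq_to_K] at hmain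
  have hnorm : ‖((‖e‖ : ℂ)) ^ 2‖ = ‖e‖ * ‖e‖ := by simp [sq]
  rcases eq_or_ne e 0 with h0 | h0
  · -- for a vanishing error the right-hand side has to be nonnegative
    have hκ : 0 ≤ kappa ρ x := Real.sSup_nonneg (by rintro _ ⟨z, _, rfl⟩; exact norm_nonneg _)
    have hr0 : 0 ≤ rate ρ t := div_nonneg (by positivity) (by linarith)
    have hr1 : 0 ≤ 1 - rate ρ t :=
      sub_nonneg.2 ((div_lt_one (by linarith)).2 (add_sqrt_lt hρ ht htρ)).le
    have hC0 : 0 ≤ extrapConst M R := by unfold extrapConst; positivity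
    have hρ1 : 0 ≤ ρ - 1 := by linarith
    rw [h0, norm_zero]
    positivity
  · refine le_of_mul_le_mul_left ?_ (norm_pos_iff.2 h0)
    calc ‖e‖ * ‖e‖ = _ := hnorm.symm
      _ ≤ _ := hmain
      _ = _ := by ring

end ChebExtrapolation

end

theorem theorem3 (n M R : ℕ) (hM : 2 ≤ M) (hR : (R : ℝ) ≤ 1 / 2 * √((M : ℝ) - 1))
    (ρ : ℝ) (hρ : 1 < ρ)
    (A : ℂ → Matrix (Fin n) (Fin n) ℂ) (b : ℂ → Fin n → ℂ)
    (hA : ∀ i j, ChebExtrapolation.AnalyticOnEllipse ρ (fun z => A z i j))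
    (hb : ∀ i, ChebExtrapolation.AnalyticOnEllipse ρ (fun z => b z i))
    (hinv : ∀ z ∈ ChebExtrapolation.closedBernsteinEllipse ρ, IsUnit (A z)) :
    let x := ChebExtrapolation.solution A b
    let p := ChebExtrapolation.chebFit M R x
    let κ := ChebExtrapolation.kappa ρ x
    ChebExtrapolation.IsLeastSquaresFit M R x p ∧
    (∀ v, ChebExtrapolation.IsLeastSquaresFit M R x v → v = p) ∧
    ∀ t : ℝ, 1 < t → t < (ρ + ρ⁻¹) / 2 →
      let r := ChebExtrapolation.rate ρ t
      r < 1 ∧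
      ‖x (t : ℂ) - ChebExtrapolation.evalVec p (t : ℂ)‖ ≤
        2 * κ * (1 / (1 - r) +
          ChebExtrapolation.extrapConst M R * ρ / ((ρ - 1) * √(ρ ^ 2 * r ^ 2 - 1))) *
          r ^ (R + 1) := by
  intro x p κ
  refine ⟨ChebExtrapolation.isLeastSquaresFit_chebFit hM hR x,
    fun v hv => hv.eq_chebFit hM hR, fun t ht htρ => ⟨?_, ?_⟩⟩
  · exact (div_lt_one (by linarith)).2 (ChebExtrapolation.add_sqrt_lt hρ ht htρ)
  · exact ChebExtrapolation.norm_sub_evalVec_chebFit_le hM hR hρ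
      (ChebExtrapolation.AnalyticOnEllipse.solution hA hb hinv) ht htρ
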